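/- Let $X$ be a countable set and let $k:X\times X\to\mathbb R$ satisfy $k(x,y)\ge 0$ for $x\ne y$ and $\sum_{y}k(x,y)=0$ for every $x$ (absolutely convergent). Put $M_1(x)=\sum_{y\neq x}k(x,y)$, $M_2(x)=\sum_{y\ne x}k(x,y)\,M_1(y)$, and $Lf(x)=\sum_{y}k(x,y)(f(y)-f(x))$. Assume that $M_2(x)<\infty$ for all $x$, that the continuous-time Markov chain generated by $L$ is irreducible, and that it has a reversible invariant probability measure $\mu$ with density $\pi:X\to(0,\infty)$, i.e. $\sum_x\pi(x)=1$ and $\pi(x)k(x,y)=\pi(y)k(y,x)$ for all $x,y$. Assume further that $M_1\in\ell^2(\mu)$, $M_2\in\ell^1(\mu)$, and that the chain is positive recurrent. For $\Upsilon(r)=e^r-r-1$ and bounded $f:X\to\mathbb R$ let $$\Psi_\Upsilon(f)(x)=\sum_y k(x,y)\Upsilon(f(y)-f(x)),$$ $$\Psi_{2,\Upsilon}(f)(x)=\tfrac12\Big(L\Psi_\Upsilon(f)(x)-\sum_y k(x,y)\,\Upsilon'(f(y)-f(x))\,(Lf(y)-Lf(x))\Big).$$ Let $\kappa>0$, $\delta\ge1$,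 $n\in(0,\infty)$ and $F(r)=r^{1+\delta}/n$ for $r\ge0$, with $F_0(r)=F(r)$ for $r\ge 0$ and $F_0(r)=0$ for $r<0$. Assume that $L$ satisfies $CD_\Upsilon(\kappa,F)$, that is, $$\Psi_{2,\Upsilon}(f)\ \ge\ \kappa\,\Psi_\Upsilon(f)+F_0(-Lf)\quad\text{on }X\text{ for every bounded }f:X\to\mathbb R .$$ For positive $f\in\ell^1(\mu)$ let $\mathrm{Ent}_\mu(f)=\int_X f\log f\,d\mu-\int_X f\,d\mu\,\log\int_X f\,d\mu$, and for positive $f$ let $$\mathcal I(f)=\tfrac12\sum_{x,y}k(x,y)(f(y)-f(x))(\log f(y)-\log f(x))\pi(x)\in[0,\infty].$$ Define $$\Phi(r)=\frac{(\kappa n)^{1/\delta}}{2\kappa}\int_{(\kappa n)^{1/\delta}/r}^\infty\frac{v^{\delta-2}}{v^\delta+1}\,dv,\qquad r>0 .$$ Then the integral converges for every $r>0$, $\Phi:(0,\infty)\to(0,\infty)$ is a growth function, i.e. it is strictly increasing, concave and $C^1$, and $EI(\Phi)$ holds: with $\Phi(0):=\lim_{r\to0^+}\Phi(r)$, $$\mathrm{Ent}_\mu(f)\le\Phi(\mathcal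 I(f))$$ for every $f:X\to(0,\infty)$ with $\int_X f\,d\mu=1$, $\mathrm{Ent}_\mu(f)<\infty$ and $\mathcal I(f)<\infty$. Moreover: (i) $\Phi$ is bounded if and only if $\delta>1$; (ii) $\int_0^\infty \Phi(s^2)/s^2\,ds<\infty$. -/

import Mathlib

open Set Filter Topology MeasureTheory ProbabilityTheory
open scoped ENNReal

noncomputable section

namespace MarkovEI

variable {X : Type*}

/-! ### Transition rates and the standing assumptions -/

open Classical in
/-- The jump rates of `k`: the off-diagonal part of the array `k`. -/
def offRate (k : X → X → ℝ) (x y : X) : ℝ := if y = x then 0 else k x y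

/-- `M₁(x) = ∑_{y ≠ x} k(x,y)`. -/
def M₁ (k : X → X → ℝ) (x : X) : ℝ := ∑' y, offRate k x y

/-- `M₂(x) = ∑_{y ≠ x} k(x,y) ∑_{z ≠ y} k(y,z)`. -/
def M₂ (k : X → X → ℝ) (x : X) : ℝ := ∑' y, offRate k x y * M₁ k y

/-- An irreducible reversible Markov generator on `X` with transition rates `k` and with
reversible probability measure of density `π` with respect to the counting measure.
`M₁(x) < ∞` is contained in `row_sum`, as `k x` is summable; `M₂(x) < ∞` is `summable_M₂`. -/
structure ReversibleGenerator (X : Type*) where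
  /-- the transition rates -/
  k : X → X → ℝ
  /-- the density of the invariant measure -/
  π : X → ℝ
  rate_nonneg : ∀ x y, x ≠ y → 0 ≤ k x y
  row_sum : ∀ x, HasSum (k x) 0
  irreducible : ∀ x y, Relation.ReflTransGen (fun a b => a ≠ b ∧ 0 < k a b) x y
  π_pos : ∀ x, 0 < π x
  π_sum : HasSum π 1
  detailed_balance : ∀ x y, π x * k x y = π y * k y x
  summable_M₂ : ∀ x, Summable fun y => offRate k x y * M₁ k y

/-! ### The operators of the curvature-dimension condition -/

/-- `L f (x) = ∑_y k(x,y) (f(y) - f(x))`. -/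
def gen (k : X → X → ℝ) (f : X → ℝ) (x : X) : ℝ := ∑' y, k x y * (f y - f x)

/-- `Ψ_H(f)(x) = ∑_y k(x,y) H(f(y) - f(x))`. -/
def Psi (k : X → X → ℝ) (H : ℝ → ℝ) (f : X → ℝ) (x : X) : ℝ := ∑' y, k x y * H (f y - f x)

/-- `B_H(f,g)(x) = ∑_y k(x,y) H(f(y) - f(x)) (g(y) - g(x))`. -/
def Bform (k : X → X → ℝ) (H : ℝ → ℝ) (f g : X → ℝ) (x : X) : ℝ :=
  ∑' y, k x y * H (f y - f x) * (g y - g x)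

/-- `Ψ_{2,H}(f) = (L Ψ_H(f) - B_{H'}(f, L f)) / 2`. -/
def Psi2 (k : X → X → ℝ) (H : ℝ → ℝ) (f : X → ℝ) (x : X) : ℝ :=
  (gen k (Psi k H f) x - Bform k (deriv H) f (gen k f) x) / 2

/-- `Υ(r) = e^r - r - 1`. -/
def Upsilon (r : ℝ) : ℝ := Real.exp r - r - 1

/-- `CD`-functions `F : [0,∞) → [0,∞)`; the values of `F` at negative numbers are irrelevant. -/
structure IsCDFunction (F : ℝ → ℝ) : Prop where
  continuousOn : ContinuousOn F (Ici 0)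
  nonneg : ∀ r, 0 ≤ r → 0 ≤ F r
  zero : F 0 = 0
  strictMono : StrictMonoOn (fun r => F r / r) (Ioi 0)
  integrable_inv : IntegrableAtFilter (fun r => 1 / F r) atTop

/-- The trivial extension of `F : [0,∞) → [0,∞)`: it vanishes on the negative half-line. -/
def trivialExt (F : ℝ → ℝ) (r : ℝ) : ℝ := if 0 ≤ r then F r else 0

/-- The condition `CD_Υ(κ,F)`, for a `CD`-function `F`: the inequality
`Ψ_{2,Υ}(f) ≥ κ Ψ_Υ(f) + F₀(-L f)` holds on `X` for every bounded `f`. -/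
def CDUpsilon (k : X → X → ℝ) (κ : ℝ) (F : ℝ → ℝ) : Prop :=
  IsCDFunction F ∧ ∀ f : X → ℝ, (∃ C, ∀ x, |f x| ≤ C) → ∀ x,
    κ * Psi k Upsilon f x + trivialExt F (-gen k f x) ≤ Psi2 k Upsilon f x

/-- The power-type function `F(r) = r^{1+δ} / n`. -/
def powerCD (δ n : ℝ) (r : ℝ) : ℝ := r ^ (1 + δ) / n

theorem isCDFunction_powerCD {δ n : ℝ} (hδ : 0 < δ) (hn : 0 < n) :
    IsCDFunction (powerCD δ n) where
  continuousOn := by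
    unfold powerCD
    exact ((Real.continuous_rpow_const (by linarith)).div_const n).continuousOn
  nonneg r hr := div_nonneg (Real.rpow_nonneg hr _) hn.le
  zero := by simp [powerCD, Real.zero_rpow (by linarith : (1 + δ) ≠ 0)]
  strictMono := by
    intro a ha b hb hab
    simp only [mem_Ioi] at ha hb
    have h : ∀ r : ℝ, 0 < r → powerCD δ n r / r = r ^ δ / n := by
      intro r hr
      rw [powerCD, Real.rpow_add hr, Real.rpow_one]
      field_simp
    simp only [h a ha, h b hb]
    exact div_lt_div_of_pos_right (Real.rpow_lt_rpow ha.le hab hδ) hn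
  integrable_inv := by
    refine ⟨Ioi 1, Ioi_mem_atTop 1, ?_⟩
    have h : IntegrableOn (fun r : ℝ => n * r ^ (-(1 + δ))) (Ioi 1) :=
      (integrableOn_Ioi_rpow_of_lt (by linarith : -(1 + δ) < -1) one_pos).const_mul n
    refine h.congr_fun (fun r hr => ?_) measurableSet_Ioi
    have hr : (0 : ℝ) < r := lt_trans one_pos hr
    simp only [powerCD]
    rw [Real.rpow_neg hr.le, one_div_div, div_eq_mul_inv]

/-! ### Entropy, Fisher information and entropy-information inequalities -/

/-- `Ent_μ(f) = ∫ f log f dμ - ∫ f dμ log ∫ f dμ`, for positive `f` with `f` and `f log f`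
in `ℓ¹(μ)`. -/
def entropy (π f : X → ℝ) : ℝ :=
  (∑' x, f x * Real.log (f x) * π x) - (∑' x, f x * π x) * Real.log (∑' x, f x * π x)

/-- `Ent_μ(f) < ∞` for positive `f ∈ ℓ¹(μ)`: as `t log t ≥ -1/e` and `μ` is finite, this says that
`f log f` is in `ℓ¹(μ)`. -/
def FiniteEntropy (π f : X → ℝ) : Prop := Summable fun x => f x * Real.log (f x) * π x

/-- `I(f) = ½ ∑_{x,y} k(x,y) (f(y) - f(x)) (log f(y) - log f(x)) π(x)`, a sum of nonnegative terms
for positive `f`, with values in `[0,∞]`. -/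
def fisherInfo (k : X → X → ℝ) (π f : X → ℝ) : ℝ≥0∞ :=
  (1 / 2) * ∑' x, ∑' y,
    ENNReal.ofReal (k x y * (f y - f x) * (Real.log (f y) - Real.log (f x)) * π x)

/-- Growth functions: strictly increasing concave `C¹`-functions `(0,∞) → (0,∞)`. -/
structure IsGrowthFunction (Φ : ℝ → ℝ) : Prop where
  pos : ∀ r, 0 < r → 0 < Φ r
  strictMono : StrictMonoOn Φ (Ioi 0)
  concave : ConcaveOn ℝ (Ioi 0) Φ
  contDiff : ContDiffOn ℝ 1 Φ (Ioi 0)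

/-- `Φ` extended to `0` by `Φ(0) := lim_{r → 0+} Φ(r)`. -/
def extendZero (Φ : ℝ → ℝ) (r : ℝ) : ℝ := if r = 0 then limUnder (𝓝[>] (0 : ℝ)) Φ else Φ r

/-- The entropy-information inequality `EI(Φ)`: `Φ` is a growth function, and
`Ent_μ(f) ≤ Φ(I(f))` for every strictly positive probability density `f` with respect to `μ`
with finite entropy and finite Fisher information. -/
def EI (k : X → X → ℝ) (π : X → ℝ) (Φ : ℝ → ℝ) : Prop :=
  IsGrowthFunction Φ ∧ ∀ f : X → ℝ, (∀ x, 0 < f x) → HasSum (fun x => f x * π x) 1 →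
    FiniteEntropy π f → fisherInfo k π f < ∞ →
      entropy π f ≤ extendZero Φ (fisherInfo k π f).toReal

/-- `Φ(r) = ((κn)^{1/δ} / (2κ)) ∫_{(κn)^{1/δ}/r}^∞ v^{δ-2} / (v^δ + 1) dv`. -/
def powerGrowth (κ δ n : ℝ) (r : ℝ) : ℝ :=
  (κ * n) ^ (1 / δ) / (2 * κ) *
    ∫ v in Ioi ((κ * n) ^ (1 / δ) / r), v ^ (δ - 2) / (v ^ δ + 1)

/-! ### The Markov chain of the generator and positive recurrence -/

namespace ReversibleGenerator

theorem offRate_nonneg (C : ReversibleGenerator X) (x y : X) : 0 ≤ offRate C.k x y := by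
  unfold offRate
  split_ifs with h
  · exact le_rfl
  · exact C.rate_nonneg x y (Ne.symm h)

theorem summable_offRate (C : ReversibleGenerator X) (x : X) : Summable (offRate C.k x) := by
  refine Summable.of_norm_bounded (C.row_sum x).summable.norm fun y => ?_
  unfold offRate
  split_ifs
  · simp
  · exact le_rfl

theorem tsum_ofReal_offRate (C : ReversibleGenerator X) (x : X) :
    ∑' y, ENNReal.ofReal (offRate C.k x y) = ENNReal.ofReal (M₁ C.k x) :=
  (ENNReal.ofReal_tsum_of_nonneg (C.offRate_nonneg x) (C.summable_offRate x)).symm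

theorem M₁_nonneg (C : ReversibleGenerator X) (x : X) : 0 ≤ M₁ C.k x :=
  tsum_nonneg (C.offRate_nonneg x)

open Classical in
/-- One step of the jump chain: from `x` it jumps to `y ≠ x` with probability `k(x,y) / M₁(x)`;
an absorbing state (`M₁(x) = 0`) is never left. -/
def jumpPMF (C : ReversibleGenerator X) (x : X) : PMF X :=
  if h : M₁ C.k x = 0 then PMF.pure x
  else PMF.normalize (fun y => ENNReal.ofReal (offRate C.k x y))
    (by
      rw [C.tsum_ofReal_offRate]
      exact (ENNReal.ofReal_pos.2 (lt_of_le_of_ne (C.M₁_nonneg x) (Ne.symm h))).ne')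
    (by
      rw [C.tsum_ofReal_offRate]
      exact ENNReal.ofReal_ne_top)

section PathSpace

variable [Countable X] [MeasurableSpace X] [DiscreteMeasurableSpace X]

/-- The transition kernel of the jump chain. -/
def jumpKernel (C : ReversibleGenerator X) : Kernel X X :=
  Kernel.ofFunOfCountable fun x => (C.jumpPMF x).toMeasure

instance (C : ReversibleGenerator X) : IsMarkovKernel C.jumpKernel :=
  ⟨fun x => by
    change IsProbabilityMeasure (C.jumpPMF x).toMeasure
    infer_instance⟩

/-- The law of the jump chain `(Y_m)` started at `x`. -/
def jumpChainLaw (C : ReversibleGenerator X) (x : X) : Measure (ℕ → X) :=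
  Kernel.trajMeasure (X := fun _ => X) (Measure.dirac x) fun m =>
    C.jumpKernel.comap (fun h : (i : Finset.Iic m) → X => h ⟨m, Finset.mem_Iic.2 le_rfl⟩)
      (measurable_pi_apply _)

/-- The law of the jump chain `(Y_m)` started at `x`, together with an independent sequence
`(e_m)` of independent exponential variables of parameter `1`. -/
def pathLaw (C : ReversibleGenerator X) (x : X) : Measure ((ℕ → X) × (ℕ → ℝ)) :=
  (C.jumpChainLaw x).prod (Measure.infinitePi fun _ : ℕ => expMeasure 1)

/-- The time of the `m`-th jump of the (minimal) continuous-time chain with jump chain `Y` and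
holding times `e_j / M₁(Y_j)`. -/
def jumpTime (C : ReversibleGenerator X) (ω : (ℕ → X) × (ℕ → ℝ)) (m : ℕ) : ℝ≥0∞ :=
  ∑ j ∈ Finset.range m, ENNReal.ofReal (ω.2 j / M₁ C.k (ω.1 j))

/-- The first time at or after the first jump at which the continuous-time chain is in `x`;
it is `∞` if this never happens. -/
def returnTime (C : ReversibleGenerator X) (x : X) (ω : (ℕ → X) × (ℕ → ℝ)) : ℝ≥0∞ :=
  ⨅ (m : ℕ) (_ : 1 ≤ m ∧ ω.1 m = x), C.jumpTime ω m

/-- Positive recurrence: every state is absorbing or has finite mean return time. -/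
def PositiveRecurrent (C : ReversibleGenerator X) : Prop :=
  ∀ x, M₁ C.k x = 0 ∨ ∫⁻ ω, C.returnTime x ω ∂(C.pathLaw x) < ∞

end PathSpace

end ReversibleGenerator

end MarkovEI

end

noncomputable section

namespace MarkovEI

/-! ### The growth function -/

/-! Along the heat flow of `L` the entropy dissipates at rate `I`. The curvature-dimension
condition, applied to the logarithm of the density and integrated with Jensen's inequality, gives
`I' ≤ -2 (κ I + F(I))`. The substitution `v = (κn)^{1/δ} / s` shows that `Φ` is the antiderivative
of `r / (2 (κ r + F(r)))`. Hence `Φ(I)` decreases at least as fast as the entropy, so `Ent - Φ(I)`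
is nondecreasing in time; as both terms tend to `0`, it is nonpositive at the start.

The argument is run on the implicit Euler scheme `g = f + h L g` (`exists_resolvent`) instead of the
semigroup. Convexity turns each derivative into a one-step inequality: the tangent of the Fisher
information gives `fisherReal_step`, the tangent of `r log r` gives `entropy_step` up to `O(h²)`,
and concavity of `Φ` gives `extendZero_powerGrowth_step` up to `O(h²)`. Summing over steps with
total time tending to infinity and total error tending to zero, and using irreducibility for the
final state (`tendsto_entropy_zero`), proves the inequality for densities in some `[c, B]` with `c >
0` (`entropy_le_of_bounded`). Truncation and normalisation extend it to all admissible densities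
(`entropy_le`).

The properties of `Φ` come from its explicit derivative and from power bounds on the integrand. -/

/-- The integrand in the definition of `powerGrowth`. -/
def growthKernel (δ v : ℝ) : ℝ := v ^ (δ - 2) / (v ^ δ + 1)

theorem growthKernel_nonneg {δ v : ℝ} (hv : 0 < v) : 0 ≤ growthKernel δ v := by
  unfold growthKernel; positivity

/-- The term `v ^ p` handles `v ≤ 1` and `v ^ (p + δ)` handles `v ≥ 1`. The free exponent serves
three purposes: `-2` gives the linear bound on `Φ`, `-5/4` a sublinear one, and `δ - 2`
integrability at `0` when `δ > 1`. -/
theorem growthKernel_le_rpow {δ p v : ℝ} (hv : 0 < v) (h₁ : p ≤ -2 + δ) (h₂ : -2 ≤ p) :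
    growthKernel δ v ≤ v ^ p := by
  unfold growthKernel
  rw [div_le_iff₀ (by positivity), mul_add, mul_one, ← Real.rpow_add hv]
  rcases le_total v 1 with h | h
  · have := Real.rpow_le_rpow_of_exponent_ge hv h (show p ≤ δ - 2 by linarith)
    have : 0 < v ^ (p + δ) := by positivity
    linarith
  · have := Real.rpow_le_rpow_of_exponent_le h (show δ - 2 ≤ p + δ by linarith)
    have : 0 < v ^ p := by positivity
    linarith

theorem continuousOn_growthKernel (δ : ℝ) : ContinuousOn (growthKernel δ) (Ioi 0) := by
  unfold growthKernel
  refine ContinuousOn.div ?_ ?_ ?_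
  · exact fun v hv => (Real.continuousAt_rpow_const _ _ (Or.inl hv.ne')).continuousWithinAt
  · exact fun v hv =>
      ((Real.continuousAt_rpow_const _ _ (Or.inl hv.ne')).add continuousAt_const).continuousWithinAt
  · intro v hv
    have : 0 < v := hv
    positivity

theorem integrableOn_growthKernel {δ t : ℝ} (hδ : 0 ≤ δ) (ht : 0 < t) :
    IntegrableOn (growthKernel δ) (Ioi t) := by
  refine Integrable.mono' (integrableOn_Ioi_rpow_of_lt (by norm_num : (-2 : ℝ) < -1) ht)
    (((continuousOn_growthKernel δ).mono (Ioi_subset_Ioi ht.le)).aestronglyMeasurable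
      measurableSet_Ioi) ?_
  filter_upwards [ae_restrict_mem measurableSet_Ioi] with v hv
  have hv0 : 0 < v := ht.trans hv
  rw [Real.norm_of_nonneg (growthKernel_nonneg hv0)]
  exact growthKernel_le_rpow hv0 (by linarith) le_rfl

/-- The tail integral of `growthKernel`. -/
def growthTail (δ t : ℝ) : ℝ := ∫ v in Ioi t, growthKernel δ v

theorem growthTail_nonneg {δ t : ℝ} (ht : 0 < t) : 0 ≤ growthTail δ t :=
  setIntegral_nonneg measurableSet_Ioi fun _ hv => growthKernel_nonneg (ht.trans hv)

theorem growthTail_le_rpow {δ p t : ℝ} (hδ : 0 ≤ δ) (ht : 0 < t) (h₁ : p ≤ -2 + δ) (h₂ : -2 ≤ p)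
    (h₃ : p < -1) : growthTail δ t ≤ -t ^ (p + 1) / (p + 1) := by
  rw [← integral_Ioi_rpow_of_lt h₃ ht]
  exact setIntegral_mono_on (integrableOn_growthKernel hδ ht) (integrableOn_Ioi_rpow_of_lt h₃ ht)
    measurableSet_Ioi fun v hv => growthKernel_le_rpow (ht.trans hv) h₁ h₂

theorem hasDerivAt_growthTail {δ t : ℝ} (hδ : 0 ≤ δ) (ht : 0 < t) :
    HasDerivAt (growthTail δ) (-growthKernel δ t) t := by
  have h2 : 0 < t / 2 := by positivity
  have hint : IntervalIntegrable (growthKernel δ) volume (t / 2) t := by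
    rw [intervalIntegrable_iff_integrableOn_Ioc_of_le (by linarith)]
    exact (integrableOn_growthKernel hδ h2).mono_set Ioc_subset_Ioi_self
  have h := intervalIntegral.integral_hasDerivAt_right hint
    ((continuousOn_growthKernel δ).stronglyMeasurableAtFilter isOpen_Ioi t ht)
    ((continuousOn_growthKernel δ).continuousAt (Ioi_mem_nhds ht))
  -- Near `t` the tail equals the fixed tail from `t / 2` minus the integral over `[t / 2, s]`, so
  -- the fundamental theorem of calculus applies.
  refine (h.const_sub (growthTail δ (t / 2))).congr_of_eventuallyEq ?_
  filter_upwards [Ioi_mem_nhds (show t / 2 < t by linarith)] with s hs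
  have := intervalIntegral.integral_Ioi_sub_Ioi (integrableOn_growthKernel hδ h2) (le_of_lt hs)
  simp only [growthTail]
  linarith

section PowerGrowth

variable {κ δ n : ℝ}

theorem powerGrowth_eq (κ δ n r : ℝ) : powerGrowth κ δ n r =
    (κ * n) ^ (1 / δ) / (2 * κ) * growthTail δ ((κ * n) ^ (1 / δ) / r) := rfl

/-- Since `F(r) = r · r ^ δ / n`, this is the equation `Φ'(r) · 2 (κ r + F(r)) = r`, the only
feature of `Φ` that links it to the dissipation of the Fisher information. -/
theorem hasDerivAt_powerGrowth (hκ : 0 < κ) (hδ : 1 ≤ δ) (hn : 0 < n) {r : ℝ} (hr : 0 < r) :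
    HasDerivAt (powerGrowth κ δ n) (1 / (2 * (κ + r ^ δ / n))) r := by
  have ha : 0 < (κ * n) ^ (1 / δ) := by positivity
  have had : ((κ * n) ^ (1 / δ)) ^ δ = κ * n := by
    rw [← Real.rpow_mul (by positivity), one_div_mul_cancel (by linarith), Real.rpow_one]
  have hf : powerGrowth κ δ n = fun r =>
      (κ * n) ^ (1 / δ) / (2 * κ) * growthTail δ ((κ * n) ^ (1 / δ) / r) :=
    funext (powerGrowth_eq κ δ n)
  rw [hf]
  set a := (κ * n) ^ (1 / δ)
  have h1 : HasDerivAt (fun r : ℝ => a / r) (-a / r ^ 2) r := by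
    have := (hasDerivAt_inv hr.ne').const_mul a
    simp only [div_eq_mul_inv]
    convert! this using 1
    ring
  have h2 := ((hasDerivAt_growthTail (by linarith : (0 : ℝ) ≤ δ) (div_pos ha hr)).comp r
    h1).const_mul (a / (2 * κ))
  refine h2.congr_deriv ?_
  have hv : 0 < a / r := div_pos ha hr
  unfold growthKernel
  rw [Real.rpow_sub hv, Real.div_rpow ha.le hr.le, had, Real.rpow_two]
  have : 0 < r ^ δ := by positivity
  field_simp

theorem powerGrowth_nonneg (hκ : 0 < κ) (hn : 0 < n) {r : ℝ} (hr : 0 < r) :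
    0 ≤ powerGrowth κ δ n r := by
  rw [powerGrowth_eq]
  exact mul_nonneg (by positivity) (growthTail_nonneg (by positivity))

theorem powerGrowth_le (hκ : 0 < κ) (hδ : 1 ≤ δ) (hn : 0 < n) {r : ℝ} (hr : 0 < r) :
    powerGrowth κ δ n r ≤ r / (2 * κ) := by
  have ha : 0 < (κ * n) ^ (1 / δ) := by positivity
  rw [powerGrowth_eq]
  set a := (κ * n) ^ (1 / δ)
  have h := growthTail_le_rpow (p := -2) (by linarith : 0 ≤ δ) (div_pos ha hr) (by linarith) le_rfl
    (by norm_num)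
  rw [show (-2 + 1 : ℝ) = -1 by norm_num, Real.rpow_neg_one] at h
  calc a / (2 * κ) * growthTail δ (a / r)
      ≤ a / (2 * κ) * (-(a / r)⁻¹ / -1) := mul_le_mul_of_nonneg_left h (by positivity)
    _ = r / (2 * κ) := by field_simp

/-- The exponent `-5/4` is below `-1`, so the tail converges, and at most `δ - 2` for every `δ ≥ 1`.
Any growth slower than `r ^ (1/2)` suffices for the integrability of `Φ(s²)/s²` at infinity. -/
theorem powerGrowth_le_rpow (hκ : 0 < κ) (hδ : 1 ≤ δ) (hn : 0 < n) {r : ℝ} (hr : 0 < r) :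
    powerGrowth κ δ n r ≤ 4 * (κ * n) ^ (1 / δ) / (2 * κ) * ((κ * n) ^ (1 / δ)) ^ (-1 / 4 : ℝ) *
      r ^ (1 / 4 : ℝ) := by
  have ha : 0 < (κ * n) ^ (1 / δ) := by positivity
  rw [powerGrowth_eq]
  set a := (κ * n) ^ (1 / δ)
  have h := growthTail_le_rpow (p := -5 / 4) (by linarith : 0 ≤ δ) (div_pos ha hr) (by linarith)
    (by norm_num) (by norm_num)
  rw [show (-5 / 4 + 1 : ℝ) = -1 / 4 by norm_num, Real.div_rpow ha.le hr.le,
    show r ^ (-1 / 4 : ℝ) = (r ^ (1 / 4 : ℝ))⁻¹ by rw [← Real.rpow_neg hr.le]; norm_num] at h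
  calc _ ≤ a / (2 * κ) * (-(a ^ (-1 / 4 : ℝ) / (r ^ (1 / 4 : ℝ))⁻¹) / (-1 / 4)) :=
        mul_le_mul_of_nonneg_left h (by positivity)
    _ = _ := by
        rw [div_inv_eq_mul]
        ring

theorem strictMonoOn_powerGrowth (hκ : 0 < κ) (hδ : 1 ≤ δ) (hn : 0 < n) :
    StrictMonoOn (powerGrowth κ δ n) (Ioi 0) := by
  refine strictMonoOn_of_deriv_pos (convex_Ioi 0)
    (fun r hr => (hasDerivAt_powerGrowth hκ hδ hn hr).continuousAt.continuousWithinAt) ?_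
  intro r hr
  rw [interior_Ioi] at hr
  have : 0 < r := hr
  rw [(hasDerivAt_powerGrowth hκ hδ hn hr).deriv]
  positivity

theorem isGrowthFunction_powerGrowth (hκ : 0 < κ) (hδ : 1 ≤ δ) (hn : 0 < n) :
    IsGrowthFunction (powerGrowth κ δ n) where
  pos r hr := (powerGrowth_nonneg hκ hn (half_pos hr)).trans_lt
    (strictMonoOn_powerGrowth hκ hδ hn (half_pos hr) hr (half_lt_self hr))
  strictMono := strictMonoOn_powerGrowth hκ hδ hn
  concave := by
    refine AntitoneOn.concaveOn_of_deriv (convex_Ioi 0)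
      (fun r hr => (hasDerivAt_powerGrowth hκ hδ hn hr).continuousAt.continuousWithinAt)
      (fun r hr => ?_) ?_
    · rw [interior_Ioi] at hr
      exact (hasDerivAt_powerGrowth hκ hδ hn hr).differentiableAt.differentiableWithinAt
    · rw [interior_Ioi]
      intro r hr s hs hrs
      have hr' : 0 < r := hr
      rw [(hasDerivAt_powerGrowth hκ hδ hn hr).deriv, (hasDerivAt_powerGrowth hκ hδ hn hs).deriv]
      gcongr
  contDiff := by
    rw [show (1 : WithTop ℕ∞) = 0 + 1 by simp, contDiffOn_succ_iff_deriv_of_isOpen isOpen_Ioi]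
    refine ⟨fun r hr =>
      (hasDerivAt_powerGrowth hκ hδ hn hr).differentiableAt.differentiableWithinAt, by simp, ?_⟩
    rw [contDiffOn_zero]
    have : ContinuousOn (fun r : ℝ => 1 / (2 * (κ + r ^ δ / n))) (Ioi 0) := by
      refine continuousOn_const.div (Continuous.continuousOn ?_) ?_
      · exact continuous_const.mul (continuous_const.add
          ((Real.continuous_rpow_const (by linarith)).div_const n))
      · intro r hr
        have : 0 < r := hr
        positivity
    exact this.congr fun r hr => (hasDerivAt_powerGrowth hκ hδ hn hr).deriv

theorem tendsto_powerGrowth_zero (hκ : 0 < κ) (hδ : 1 ≤ δ) (hn : 0 < n) :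
    Tendsto (powerGrowth κ δ n) (𝓝[>] 0) (𝓝 0) := by
  have h : Tendsto (fun r : ℝ => r / (2 * κ)) (𝓝[>] 0) (𝓝 0) := by
    have : Tendsto (fun r : ℝ => r / (2 * κ)) (𝓝 0) (𝓝 (0 / (2 * κ))) :=
      tendsto_id.div_const _
    rw [zero_div] at this
    exact this.mono_left nhdsWithin_le_nhds
  refine tendsto_of_tendsto_of_tendsto_of_le_of_le' tendsto_const_nhds h ?_ ?_
  · filter_upwards [self_mem_nhdsWithin] with r hr using powerGrowth_nonneg hκ hn hr
  · filter_upwards [self_mem_nhdsWithin] with r hr using powerGrowth_le hκ hδ hn hr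

theorem extendZero_powerGrowth_zero (hκ : 0 < κ) (hδ : 1 ≤ δ) (hn : 0 < n) :
    extendZero (powerGrowth κ δ n) 0 = 0 := by
  simp only [extendZero, if_true]
  exact (tendsto_powerGrowth_zero hκ hδ hn).limUnder_eq

theorem extendZero_of_pos {Φ : ℝ → ℝ} {r : ℝ} (hr : 0 < r) : extendZero Φ r = Φ r :=
  if_neg hr.ne'

theorem monotoneOn_extendZero_powerGrowth (hκ : 0 < κ) (hδ : 1 ≤ δ) (hn : 0 < n) :
    MonotoneOn (extendZero (powerGrowth κ δ n)) (Ici 0) := by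
  intro r hr s hs hrs
  rcases eq_or_lt_of_le (show 0 ≤ r from hr) with rfl | hr
  · rw [extendZero_powerGrowth_zero hκ hδ hn]
    rcases eq_or_lt_of_le hrs with rfl | hs
    · exact (extendZero_powerGrowth_zero hκ hδ hn).ge
    · rw [extendZero_of_pos hs]
      exact powerGrowth_nonneg hκ hn hs
  · rw [extendZero_of_pos hr, extendZero_of_pos (hr.trans_le hrs)]
    exact (strictMonoOn_powerGrowth hκ hδ hn).monotoneOn hr (hr.trans_le hrs) hrs

theorem continuousOn_extendZero_powerGrowth (hκ : 0 < κ) (hδ : 1 ≤ δ) (hn : 0 < n) :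
    ContinuousOn (extendZero (powerGrowth κ δ n)) (Ici 0) := by
  intro r hr
  rcases eq_or_lt_of_le (show 0 ≤ r from hr) with rfl | hr
  · rw [← continuousWithinAt_Ioi_iff_Ici, ContinuousWithinAt, extendZero_powerGrowth_zero hκ hδ hn]
    refine (tendsto_powerGrowth_zero hκ hδ hn).congr' ?_
    filter_upwards [self_mem_nhdsWithin] with s hs using (extendZero_of_pos hs).symm
  · refine ((hasDerivAt_powerGrowth hκ hδ hn hr).continuousAt.congr ?_).continuousWithinAt
    filter_upwards [Ioi_mem_nhds hr] with s hs using (extendZero_of_pos hs).symm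

/-- For `δ = 1` the integrand is `1 / (v (v + 1))`, which is at least `1 / (2v)` on `(0, 1]`. The
logarithmic divergence makes `Φ` unbounded in this case. -/
theorem neg_log_le_growthTail_one {t : ℝ} (ht : 0 < t) (ht1 : t ≤ 1) :
    -Real.log t / 2 ≤ growthTail 1 t := by
  have hint := integrableOn_growthKernel (zero_le_one' ℝ) ht
  have h1 : (∫ v in t..1, v⁻¹ * (1 / 2)) = -Real.log t / 2 := by
    rw [intervalIntegral.integral_mul_const, integral_inv_of_pos ht one_pos, one_div, Real.log_inv]
    ring
  rw [← h1, intervalIntegral.integral_of_le ht1]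
  calc _ ≤ ∫ v in Ioc t 1, growthKernel 1 v := by
        refine setIntegral_mono_on ?_ (hint.mono_set Ioc_subset_Ioi_self) measurableSet_Ioc ?_
        · rw [← intervalIntegrable_iff_integrableOn_Ioc_of_le ht1]
          refine (intervalIntegral.intervalIntegrable_inv (fun x hx => ?_)
            continuousOn_id).mul_const _
          rw [uIcc_of_le ht1] at hx
          exact (ht.trans_le hx.1).ne'
        · intro v hv
          have hv0 : 0 < v := ht.trans hv.1
          unfold growthKernel
          rw [show (1 - 2 : ℝ) = -1 by norm_num, Real.rpow_neg_one, Real.rpow_one,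
            div_eq_mul_inv]
          refine mul_le_mul_of_nonneg_left ?_ (by positivity)
          rw [one_mul]
          exact inv_anti₀ (by positivity) (by linarith [hv.2])
    _ ≤ _ := setIntegral_mono_set hint
        (by
          filter_upwards [ae_restrict_mem measurableSet_Ioi] with v hv using
            growthKernel_nonneg (ht.trans hv))
        (LE.le.eventuallyLE Ioc_subset_Ioi_self)

theorem bounded_powerGrowth_iff (hκ : 0 < κ) (hδ : 1 ≤ δ) (hn : 0 < n) :
    (∃ B : ℝ, ∀ r : ℝ, 0 < r → |powerGrowth κ δ n r| ≤ B) ↔ 1 < δ := by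
  constructor
  · rintro ⟨B, hB⟩
    by_contra hlt
    obtain rfl : δ = 1 := le_antisymm (not_lt.1 hlt) hδ
    have ha : 0 < κ * n := by positivity
    have hlim : Tendsto (fun r : ℝ => κ * n / (2 * κ) * (-Real.log (κ * n / r) / 2))
        atTop atTop := by
      refine Tendsto.const_mul_atTop (by positivity) ?_
      refine Tendsto.atTop_div_const two_pos ?_
      refine tendsto_neg_atBot_atTop.comp (Real.tendsto_log_nhdsGT_zero.comp ?_)
      refine tendsto_nhdsWithin_iff.2 ⟨tendsto_const_nhds.div_atTop tendsto_id, ?_⟩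
      filter_upwards [eventually_gt_atTop 0] with r hr using div_pos ha hr
    obtain ⟨r, h1, h2, h3⟩ := ((hlim.eventually_gt_atTop B).and
      ((eventually_gt_atTop 0).and (eventually_ge_atTop (κ * n)))).exists
    have h4 := hB r h2
    rw [abs_of_nonneg (powerGrowth_nonneg hκ hn h2), powerGrowth_eq, div_one, Real.rpow_one] at h4
    have h5 := mul_le_mul_of_nonneg_left (neg_log_le_growthTail_one (div_pos ha h2)
      ((div_le_one h2).2 h3)) (show 0 ≤ κ * n / (2 * κ) by positivity)
    linarith
  · intro hδ1
    -- Near `0` the integrand is at most `v ^ (δ - 2)`, integrable exactly because `δ > 1`; the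
    -- integral over the whole half-line then bounds every tail.
    have hint : IntegrableOn (growthKernel δ) (Ioi 0) := by
      rw [← Ioc_union_Ioi_eq_Ioi (zero_le_one' ℝ)]
      refine IntegrableOn.union ?_ (integrableOn_growthKernel (by linarith) one_pos)
      have h := intervalIntegral.intervalIntegrable_rpow' (a := 0) (b := 1) (r := δ - 2)
        (by linarith)
      rw [intervalIntegrable_iff_integrableOn_Ioc_of_le zero_le_one] at h
      refine Integrable.mono' h (((continuousOn_growthKernel δ).mono
        Ioc_subset_Ioi_self).aestronglyMeasurable measurableSet_Ioc) ?_
      filter_upwards [ae_restrict_mem measurableSet_Ioc] with v hv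
      have hv0 : 0 < v := hv.1
      rw [Real.norm_of_nonneg (growthKernel_nonneg hv0)]
      exact growthKernel_le_rpow hv0 (by linarith) (by linarith)
    refine ⟨(κ * n) ^ (1 / δ) / (2 * κ) * ∫ v in Ioi 0, growthKernel δ v, fun r hr => ?_⟩
    rw [abs_of_nonneg (powerGrowth_nonneg hκ hn hr), powerGrowth_eq]
    refine mul_le_mul_of_nonneg_left (setIntegral_mono_set hint ?_ ?_) (by positivity)
    · filter_upwards [ae_restrict_mem measurableSet_Ioi] with v hv using growthKernel_nonneg hv
    · exact LE.le.eventuallyLE (Ioi_subset_Ioi (by positivity))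

theorem integrableOn_powerGrowth_sq (hκ : 0 < κ) (hδ : 1 ≤ δ) (hn : 0 < n) :
    IntegrableOn (fun s : ℝ => powerGrowth κ δ n (s ^ 2) / s ^ 2) (Ioi 0) := by
  have hcont : ContinuousOn (fun s : ℝ => powerGrowth κ δ n (s ^ 2) / s ^ 2) (Ioi 0) := by
    intro s hs
    have hs0 : 0 < s := hs
    have h : ContinuousAt (fun s : ℝ => powerGrowth κ δ n (s ^ 2)) s :=
      ContinuousAt.comp (f := fun s : ℝ => s ^ 2)
        (hasDerivAt_powerGrowth hκ hδ hn (by positivity)).continuousAt (by fun_prop)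
    exact (h.div (by fun_prop) (by positivity)).continuousWithinAt
  have hnn : ∀ s : ℝ, 0 < s → 0 ≤ powerGrowth κ δ n (s ^ 2) / s ^ 2 := fun s hs =>
    div_nonneg (powerGrowth_nonneg hκ hn (by positivity)) (by positivity)
  rw [← Ioc_union_Ioi_eq_Ioi (zero_le_one' ℝ)]
  refine IntegrableOn.union ?_ ?_
  · refine Integrable.mono' (integrableOn_const (C := 1 / (2 * κ)) (by simp))
      ((hcont.mono Ioc_subset_Ioi_self).aestronglyMeasurable measurableSet_Ioc) ?_
    filter_upwards [ae_restrict_mem measurableSet_Ioc] with s hs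
    have hs0 : 0 < s := hs.1
    rw [Real.norm_of_nonneg (hnn s hs0), div_le_iff₀ (by positivity)]
    refine (powerGrowth_le hκ hδ hn (by positivity)).trans_eq (by ring)
  · refine Integrable.mono'
      ((integrableOn_Ioi_rpow_of_lt (by norm_num : (-3 / 2 : ℝ) < -1) one_pos).const_mul
        (4 * (κ * n) ^ (1 / δ) / (2 * κ) * ((κ * n) ^ (1 / δ)) ^ (-1 / 4 : ℝ)))
      ((hcont.mono (Ioi_subset_Ioi zero_le_one)).aestronglyMeasurable measurableSet_Ioi) ?_
    filter_upwards [ae_restrict_mem measurableSet_Ioi] with s hs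
    have hs0 : 0 < s := one_pos.trans hs
    rw [Real.norm_of_nonneg (hnn s hs0), div_le_iff₀ (by positivity)]
    refine (powerGrowth_le_rpow hκ hδ hn (by positivity)).trans_eq ?_
    rw [mul_assoc (4 * (κ * n) ^ (1 / δ) / (2 * κ) * ((κ * n) ^ (1 / δ)) ^ (-1 / 4 : ℝ))]
    congr 1
    rw [← Real.rpow_natCast s 2, ← Real.rpow_mul hs0.le, ← Real.rpow_add hs0]
    norm_num

end PowerGrowth

/-! ### Elementary inequalities -/

/-- The function `(a, b) ↦ (a - b) (log a - log b)` lies above its tangent planes. -/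
theorem log_sub_mul_tangent {a b a' b' : ℝ} (ha : 0 < a) (hb : 0 < b) (ha' : 0 < a')
    (hb' : 0 < b') :
    (Real.log a - Real.log b + 1 - b / a) * a' + (Real.log b - Real.log a + 1 - a / b) * b' ≤
      (a' - b') * (Real.log a' - Real.log b') := by
  have h1 := Real.log_le_sub_one_of_pos (show 0 < a' * b / (b' * a) by positivity)
  have h2 := Real.log_le_sub_one_of_pos (show 0 < b' * a / (a' * b) by positivity)
  rw [Real.log_div (by positivity) (by positivity), Real.log_mul ha'.ne' hb.ne',
    Real.log_mul hb'.ne' ha.ne'] at h1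
  rw [Real.log_div (by positivity) (by positivity), Real.log_mul ha'.ne' hb.ne',
    Real.log_mul hb'.ne' ha.ne'] at h2
  have h3 := mul_le_mul_of_nonneg_left h1 hb'.le
  have h4 := mul_le_mul_of_nonneg_left h2 ha'.le
  have e1 : b' * (a' * b / (b' * a) - 1) = b / a * a' - b' := by field_simp
  have e2 : a' * (b' * a / (a' * b) - 1) = a / b * b' - a' := by field_simp
  rw [e1] at h3
  rw [e2] at h4
  linarith

/-- `r ↦ r ^ p` lies above its tangents. -/
theorem rpow_tangent {p s t : ℝ} (hp : 1 ≤ p) (hs : 0 ≤ s) (ht : 0 ≤ t) :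
    s ^ p + p * s ^ (p - 1) * (t - s) ≤ t ^ p := by
  rcases eq_or_lt_of_le hs with rfl | hs
  · rcases eq_or_lt_of_le hp with rfl | hp
    · simp
    · rw [Real.zero_rpow (by linarith), Real.zero_rpow (by linarith)]
      simpa using Real.rpow_nonneg ht p
  · have h := one_add_mul_self_le_rpow_one_add (s := t / s - 1)
      (by linarith [div_nonneg ht hs.le]) hp
    rw [add_sub_cancel, Real.div_rpow ht hs.le, le_div_iff₀ (by positivity)] at h
    refine le_trans (le_of_eq ?_) h
    rw [Real.rpow_sub hs, Real.rpow_one]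
    field_simp

/-- `r ↦ r log r` lies above its tangents. -/
theorem mul_log_tangent {a b : ℝ} (ha : 0 < a) (hb : 0 < b) :
    a * Real.log a - b * Real.log b ≤ (Real.log a + 1) * (a - b) := by
  have h := Real.log_le_sub_one_of_pos (div_pos ha hb)
  rw [Real.log_div ha.ne' hb.ne'] at h
  have h' := mul_le_mul_of_nonneg_left h hb.le
  have e : b * (a / b - 1) = a - b := by field_simp
  rw [e] at h'
  linarith

/-- The logarithm is `1/c`-Lipschitz on `[c, ∞)`. This controls the second-order error of the
entropy in an Euler step. -/
theorem log_sub_log_mul_le {a b c : ℝ} (hc : 0 < c) (ha : c ≤ a) (hb : c ≤ b) :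
    (Real.log a - Real.log b) * (a - b) ≤ (a - b) ^ 2 / c := by
  have ha0 := hc.trans_le ha
  have hb0 := hc.trans_le hb
  have key : ∀ {a b : ℝ}, c ≤ a → c ≤ b → b ≤ a →
      (Real.log a - Real.log b) * (a - b) ≤ (a - b) ^ 2 / c := by
    intro a b ha hb hab
    have ha0 := hc.trans_le ha
    have hb0 := hc.trans_le hb
    have h := Real.log_le_sub_one_of_pos (div_pos ha0 hb0)
    rw [Real.log_div ha0.ne' hb0.ne'] at h
    have e : a / b - 1 = (a - b) / b := by field_simp
    have h2 : (a - b) / b ≤ (a - b) / c :=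
      div_le_div_of_nonneg_left (by linarith) hc hb
    have h3 := mul_le_mul_of_nonneg_right (h.trans (e.le.trans h2)) (sub_nonneg.2 hab)
    exact h3.trans_eq (by ring)
  rcases le_total b a with h | h
  · exact key ha hb h
  · have := key hb ha h
    calc _ = (Real.log b - Real.log a) * (b - a) := by ring
      _ ≤ _ := this
      _ = _ := by ring

variable {X : Type*}

theorem offRate_mul {k : X → X → ℝ} {x y : X} {a : ℝ} (h : y = x → a = 0) :
    offRate k x y * a = k x y * a := by
  unfold offRate
  split_ifs with hxy
  · rw [h hxy, mul_zero, mul_zero]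
  · rfl

theorem gen_eq_offRate (k : X → X → ℝ) (f : X → ℝ) (x : X) :
    gen k f x = ∑' y, offRate k x y * (f y - f x) :=
  tsum_congr fun y => (offRate_mul fun h => by rw [h, sub_self]).symm

theorem Psi_eq_offRate (k : X → X → ℝ) {H : ℝ → ℝ} (hH : H 0 = 0) (f : X → ℝ) (x : X) :
    Psi k H f x = ∑' y, offRate k x y * H (f y - f x) :=
  tsum_congr fun y => (offRate_mul fun h => by rw [h, sub_self, hH]).symm

theorem Bform_eq_offRate (k : X → X → ℝ) (H : ℝ → ℝ) (f g : X → ℝ) (x : X) :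
    Bform k H f g x = ∑' y, offRate k x y * (H (f y - f x) * (g y - g x)) :=
  tsum_congr fun y => by
    rw [offRate_mul fun h => by rw [h, sub_self, sub_self, mul_zero], mul_assoc]

/-! ### Weighted summability and integration by parts over edges. -/

namespace ReversibleGenerator

variable (C : ReversibleGenerator X)

/-- The symmetric edge weights `π(x) k(x,y)`, `x ≠ y`. -/
def edge (p : X × X) : ℝ := C.π p.1 * offRate C.k p.1 p.2

theorem edge_nonneg (p : X × X) : 0 ≤ C.edge p :=
  mul_nonneg (C.π_pos _).le (C.offRate_nonneg _ _)

theorem edge_swap (p : X × X) : C.edge p.swap = C.edge p := by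
  unfold edge offRate
  by_cases h : p.1 = p.2
  · simp [h]
  · simp [h, Ne.symm h, C.detailed_balance p.2 p.1]

/-- The weight `1 + M₁`. -/
def wt (x : X) : ℝ := 1 + M₁ C.k x

theorem one_le_wt (x : X) : 1 ≤ C.wt x := by
  unfold wt
  linarith [C.M₁_nonneg x]

/-- The weight `1 + M₁(x) + 1 + M₁(y)` on pairs. -/
def wt₂ (p : X × X) : ℝ := C.wt p.1 + C.wt p.2

theorem one_le_wt₂ (p : X × X) : 1 ≤ C.wt₂ p := by
  unfold wt₂
  linarith [C.one_le_wt p.1, C.one_le_wt p.2]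

variable {C}

theorem summable_wt_sq (hM : Summable fun x => M₁ C.k x ^ 2 * C.π x) :
    Summable fun x => C.wt x ^ 2 * C.π x := by
  refine Summable.of_nonneg_of_le (fun x => mul_nonneg (sq_nonneg _) (C.π_pos x).le) (fun x => ?_)
    ((C.π_sum.summable.mul_left 2).add (hM.mul_left 2))
  have := mul_nonneg (sq_nonneg (1 - M₁ C.k x)) (C.π_pos x).le
  unfold wt
  nlinarith

/-- Big-O along `⊤` is a bound with one constant on all of `X`. A product of two functions of size
`1 + M₁` is integrable because `M₁ ∈ ℓ²(μ)`. -/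
theorem summable_π_mul (hM : Summable fun x => M₁ C.k x ^ 2 * C.π x) {φ : X → ℝ}
    (hφ : φ =O[⊤] fun x => C.wt x * C.wt x) : Summable fun x => C.π x * φ x := by
  obtain ⟨B, hB⟩ := Asymptotics.isBigO_top.1 hφ
  refine Summable.of_norm_bounded ((summable_wt_sq hM).mul_left B) fun x => ?_
  have := hB x
  rw [norm_mul, Real.norm_of_nonneg (C.π_pos x).le]
  rw [Real.norm_of_nonneg (mul_self_nonneg _)] at this
  calc C.π x * ‖φ x‖ ≤ C.π x * (B * (C.wt x * C.wt x)) :=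
        mul_le_mul_of_nonneg_left this (C.π_pos x).le
    _ = _ := by ring

theorem summable_edge_mul_fst (hM : Summable fun x => M₁ C.k x ^ 2 * C.π x) :
    Summable fun p => C.edge p * C.wt p.1 := by
  have hnn : 0 ≤ fun p => C.edge p * C.wt p.1 := fun p =>
    mul_nonneg (C.edge_nonneg p) (zero_le_one.trans (C.one_le_wt _))
  rw [summable_prod_of_nonneg hnn]
  refine ⟨fun x => ?_, ?_⟩
  · exact ((C.summable_offRate x).mul_left (C.π x)).mul_right (C.wt x)
  · refine (summable_π_mul hM (φ := fun x => M₁ C.k x * C.wt x) ?_).congr fun x => ?_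
    · refine Asymptotics.IsBigO.mul (Asymptotics.isBigO_top.2 ⟨1, fun x => ?_⟩)
        (Asymptotics.isBigO_refl _ _)
      rw [Real.norm_of_nonneg (C.M₁_nonneg x), Real.norm_of_nonneg (by linarith [C.one_le_wt x])]
      unfold wt
      linarith
    · simp only [edge]
      rw [tsum_mul_right, tsum_mul_left, mul_assoc]
      rfl

/-- Summing the edge weights over the second endpoint gives `π M₁`, so a weight `1 + M₁` at the
first endpoint is affordable; symmetry of the edges covers the second endpoint. -/
theorem summable_edge_mul (hM : Summable fun x => M₁ C.k x ^ 2 * C.π x) {G : X × X → ℝ}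
    (hG : G =O[⊤] C.wt₂) : Summable fun p => C.edge p * G p := by
  obtain ⟨B, hB⟩ := Asymptotics.isBigO_top.1 hG
  have h1 := summable_edge_mul_fst hM
  have h2 : Summable fun p : X × X => C.edge p * C.wt p.2 := by
    refine ((Equiv.prodComm X X).summable_iff.2 h1).congr fun p => ?_
    simp [Function.comp, C.edge_swap]
  refine Summable.of_norm_bounded ((h1.add h2).mul_left B) fun p => ?_
  have := hB p
  rw [norm_mul, Real.norm_of_nonneg (C.edge_nonneg p)]
  rw [Real.norm_of_nonneg (zero_le_one.trans (C.one_le_wt₂ p))] at this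
  calc C.edge p * ‖G p‖ ≤ C.edge p * (B * C.wt₂ p) :=
        mul_le_mul_of_nonneg_left this (C.edge_nonneg p)
    _ = _ := by
        unfold wt₂
        ring

theorem tsum_edge {G : X × X → ℝ} (hG : Summable fun p => C.edge p * G p) :
    ∑' p, C.edge p * G p = ∑' x, C.π x * ∑' y, offRate C.k x y * G (x, y) := by
  rw [hG.tsum_prod]
  refine tsum_congr fun x => ?_
  rw [← tsum_mul_left]
  exact tsum_congr fun y => mul_assoc _ _ _

theorem tsum_edge_swap (G : X × X → ℝ) :
    ∑' p, C.edge p * G p.swap = ∑' p, C.edge p * G p := by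
  rw [← (Equiv.prodComm X X).tsum_eq fun p => C.edge p * G p]
  exact tsum_congr fun p => by simp [C.edge_swap]

theorem isBigO_fst {ψ : X → ℝ} (h : ψ =O[⊤] C.wt) :
    (fun p : X × X => ψ p.1) =O[⊤] C.wt₂ := by
  refine (h.comp_tendsto (k := fun p : X × X => p.1) tendsto_top).trans
    (Asymptotics.isBigO_top.2 ⟨1, fun p => ?_⟩)
  simp only [Function.comp]
  rw [Real.norm_of_nonneg (by linarith [C.one_le_wt p.1]),
    Real.norm_of_nonneg (by linarith [C.one_le_wt₂ p])]
  unfold wt₂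
  linarith [C.one_le_wt p.2]

theorem isBigO_snd {ψ : X → ℝ} (h : ψ =O[⊤] C.wt) :
    (fun p : X × X => ψ p.2) =O[⊤] C.wt₂ := by
  refine (h.comp_tendsto (k := fun p : X × X => p.2) tendsto_top).trans
    (Asymptotics.isBigO_top.2 ⟨1, fun p => ?_⟩)
  simp only [Function.comp]
  rw [Real.norm_of_nonneg (by linarith [C.one_le_wt p.2]),
    Real.norm_of_nonneg (by linarith [C.one_le_wt₂ p])]
  unfold wt₂
  linarith [C.one_le_wt p.1]

theorem isBigO_wt_of_one {φ : X → ℝ} (h : φ =O[⊤] fun _ => (1 : ℝ)) : φ =O[⊤] C.wt := by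
  refine h.trans (Asymptotics.isBigO_top.2 ⟨1, fun x => ?_⟩)
  rw [norm_one, Real.norm_of_nonneg (by linarith [C.one_le_wt x])]
  linarith [C.one_le_wt x]

theorem isBigO_fst_one {φ : X → ℝ} (h : φ =O[⊤] fun _ => (1 : ℝ)) :
    (fun p : X × X => φ p.1) =O[⊤] fun _ => (1 : ℝ) :=
  h.comp_tendsto (k := fun p : X × X => p.1) tendsto_top

theorem isBigO_snd_one {φ : X → ℝ} (h : φ =O[⊤] fun _ => (1 : ℝ)) :
    (fun p : X × X => φ p.2) =O[⊤] fun _ => (1 : ℝ) :=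
  h.comp_tendsto (k := fun p : X × X => p.2) tendsto_top

theorem isBigO_bdd_mul {α : Type*} {φ ψ w : α → ℝ} (hφ : φ =O[⊤] fun _ => (1 : ℝ))
    (hψ : ψ =O[⊤] w) : (fun x => φ x * ψ x) =O[⊤] w := by
  simpa using hφ.mul hψ

theorem isBigO_wt₂_of_one {G : X × X → ℝ} (h : G =O[⊤] fun _ => (1 : ℝ)) : G =O[⊤] C.wt₂ := by
  refine h.trans (Asymptotics.isBigO_top.2 ⟨1, fun x => ?_⟩)
  rw [norm_one, Real.norm_of_nonneg (by linarith [C.one_le_wt₂ x])]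
  linarith [C.one_le_wt₂ x]

theorem isBigO_tsum_offRate {G : X × X → ℝ} (h : G =O[⊤] fun _ => (1 : ℝ)) :
    (fun x => ∑' y, offRate C.k x y * G (x, y)) =O[⊤] C.wt := by
  obtain ⟨B, hB⟩ := Asymptotics.isBigO_top.1 h
  refine Asymptotics.isBigO_top.2 ⟨B, fun x => ?_⟩
  have hB' : ∀ p, ‖G p‖ ≤ B := fun p => by simpa using hB p
  have hB0 : 0 ≤ B := (norm_nonneg _).trans (hB' (x, x))
  have := tsum_of_norm_bounded (f := fun y => offRate C.k x y * G (x, y))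
    ((C.summable_offRate x).mul_right B).hasSum (fun y => by
      rw [norm_mul, Real.norm_of_nonneg (C.offRate_nonneg x y)]
      exact mul_le_mul_of_nonneg_left (hB' _) (C.offRate_nonneg x y))
  refine this.trans ?_
  rw [tsum_mul_right, Real.norm_of_nonneg (by linarith [C.one_le_wt x])]
  change M₁ C.k x * B ≤ B * (1 + M₁ C.k x)
  linarith

theorem isBigO_gen {φ : X → ℝ} (h : φ =O[⊤] fun _ => (1 : ℝ)) : gen C.k φ =O[⊤] C.wt := by
  have := isBigO_tsum_offRate (C := C) ((isBigO_snd_one h).sub (isBigO_fst_one h))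
  refine this.congr_left fun x => ?_
  rw [gen_eq_offRate]

theorem tsum_mul_gen {φ ψ : X → ℝ}
    (h : Summable fun p : X × X => C.edge p * (φ p.1 * (ψ p.2 - ψ p.1))) :
    ∑' x, C.π x * (φ x * gen C.k ψ x) =
      ∑' p : X × X, C.edge p * (φ p.1 * (ψ p.2 - ψ p.1)) := by
  rw [tsum_edge h]
  refine tsum_congr fun x => ?_
  rw [gen_eq_offRate, ← tsum_mul_left]
  congr 1
  exact tsum_congr fun y => by ring

/-- Symmetry of the generator. -/
theorem tsum_mul_gen_comm (hM : Summable fun x => M₁ C.k x ^ 2 * C.π x) {φ ψ : X → ℝ}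
    (hφ : φ =O[⊤] fun _ => (1 : ℝ)) (hψ : ψ =O[⊤] C.wt) :
    ∑' x, C.π x * (φ x * gen C.k ψ x) = ∑' x, C.π x * (ψ x * gen C.k φ x) := by
  have h12 := summable_edge_mul hM (isBigO_bdd_mul (isBigO_fst_one hφ) (isBigO_snd hψ))
  have h11 := summable_edge_mul hM (isBigO_bdd_mul (isBigO_fst_one hφ) (isBigO_fst hψ))
  have h21 := summable_edge_mul hM (isBigO_bdd_mul (isBigO_snd_one hφ) (isBigO_fst hψ))
  rw [tsum_mul_gen ((h12.sub h11).congr fun p => by ring),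
    tsum_mul_gen ((h21.sub h11).congr fun p => by ring)]
  have e1 : ∑' p : X × X, C.edge p * (φ p.1 * (ψ p.2 - ψ p.1)) =
      ∑' p : X × X, C.edge p * (φ p.1 * ψ p.2) - ∑' p : X × X, C.edge p * (φ p.1 * ψ p.1) := by
    rw [← h12.tsum_sub h11]
    exact tsum_congr fun p => by ring
  have e2 : ∑' p : X × X, C.edge p * (ψ p.1 * (φ p.2 - φ p.1)) =
      ∑' p : X × X, C.edge p * (φ p.2 * ψ p.1) - ∑' p : X × X, C.edge p * (φ p.1 * ψ p.1) := by
    rw [← h21.tsum_sub h11]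
    exact tsum_congr fun p => by ring
  rw [e1, e2, ← tsum_edge_swap fun p => φ p.1 * ψ p.2]
  rfl

/-- Green's formula: the difference of `ψ` is expanded and the endpoints are exchanged in one half.
Letting `ψ` grow like `1 + M₁` allows `ψ = L (log g)`. -/
theorem tsum_edge_mul_sub (hM : Summable fun x => M₁ C.k x ^ 2 * C.π x) {φ ψ : X → ℝ}
    (hφ : φ =O[⊤] fun _ => (1 : ℝ)) (hψ : ψ =O[⊤] C.wt) :
    ∑' p : X × X, C.edge p * ((φ p.2 - φ p.1) * (ψ p.2 - ψ p.1)) =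
      -2 * ∑' x, C.π x * (ψ x * gen C.k φ x) := by
  have h := summable_edge_mul hM
    (isBigO_bdd_mul ((isBigO_snd_one hφ).sub (isBigO_fst_one hφ)) (isBigO_fst hψ))
  have h' := summable_edge_mul hM
    (isBigO_bdd_mul ((isBigO_snd_one hφ).sub (isBigO_fst_one hφ)) (isBigO_snd hψ))
  rw [tsum_mul_gen (h.congr fun p => by ring)]
  have e := tsum_edge_swap (C := C) fun p => ψ p.1 * (φ p.2 - φ p.1)
  simp only [Prod.fst_swap, Prod.snd_swap] at e
  have e2 : ∑' p : X × X, C.edge p * ((φ p.2 - φ p.1) * (ψ p.2 - ψ p.1)) =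
      -(∑' p : X × X, C.edge p * (ψ p.2 * (φ p.1 - φ p.2))) -
        ∑' p : X × X, C.edge p * (ψ p.1 * (φ p.2 - φ p.1)) := by
    rw [← tsum_neg, ← Summable.tsum_sub]
    · exact tsum_congr fun p => by ring
    · exact h'.congr fun p => by ring
    · exact h.congr fun p => by ring
  rw [e2, e]
  ring

theorem tsum_gen_eq_zero (hM : Summable fun x => M₁ C.k x ^ 2 * C.π x) {φ : X → ℝ}
    (hφ : φ =O[⊤] fun _ => (1 : ℝ)) : ∑' x, C.π x * gen C.k φ x = 0 := by
  have h := tsum_mul_gen_comm hM (Asymptotics.isBigO_refl (fun _ : X => (1 : ℝ)) ⊤)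
    (isBigO_wt_of_one hφ)
  simp only [one_mul] at h
  rw [h]
  simp [gen]

/-! ### The implicit Euler step. -/

/-- Solvability of the resolvent equation `g - h L g = f`, with the maximum principle. -/
theorem exists_resolvent (C : ReversibleGenerator X) {h c B : ℝ} (hh : 0 < h) (hc : 0 ≤ c)
    {f : X → ℝ} (hf : ∀ x, f x ∈ Icc c B) :
    ∃ g : X → ℝ, (∀ x, g x ∈ Icc c B) ∧ ∀ x, g x = f x + h * gen C.k g x := by
  have hs : ∀ {g : X → ℝ}, (∀ x, g x ∈ Icc c B) → ∀ x,
      Summable fun y => offRate C.k x y * g y := fun {g} hg x =>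
    Summable.of_nonneg_of_le
      (fun y => mul_nonneg (C.offRate_nonneg x y) (hc.trans (hg y).1))
      (fun y => mul_le_mul_of_nonneg_left (hg y).2 (C.offRate_nonneg x y))
      ((C.summable_offRate x).mul_right B)
  have hD : ∀ x, 0 < 1 + h * M₁ C.k x := fun x => by
    have := mul_nonneg hh.le (C.M₁_nonneg x)
    linarith
  -- The resolvent equation solved for its diagonal part. `M₁` may be unbounded, so `T` need not be
  -- a contraction; it is monotone and preserves `[c, B]`.
  let T : (X → ℝ) → X → ℝ := fun g x =>
    (f x + h * ∑' y, offRate C.k x y * g y) / (1 + h * M₁ C.k x)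
  have hT : ∀ g : X → ℝ, (∀ x, g x ∈ Icc c B) → ∀ x, T g x ∈ Icc c B := by
    intro g hg x
    have h1 : M₁ C.k x * c ≤ ∑' y, offRate C.k x y * g y := by
      rw [M₁, ← tsum_mul_right]
      exact ((C.summable_offRate x).mul_right c).tsum_le_tsum
        (fun y => mul_le_mul_of_nonneg_left (hg y).1 (C.offRate_nonneg x y)) (hs hg x)
    have h2 : ∑' y, offRate C.k x y * g y ≤ M₁ C.k x * B := by
      rw [M₁, ← tsum_mul_right]
      exact (hs hg x).tsum_le_tsum
        (fun y => mul_le_mul_of_nonneg_left (hg y).2 (C.offRate_nonneg x y))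
        ((C.summable_offRate x).mul_right B)
    have h1' := mul_le_mul_of_nonneg_left h1 hh.le
    have h2' := mul_le_mul_of_nonneg_left h2 hh.le
    constructor
    · rw [le_div_iff₀ (hD x)]
      linarith [(hf x).1]
    · rw [div_le_iff₀ (hD x)]
      linarith [(hf x).2]
  have hTmono : ∀ g g' : X → ℝ, (∀ x, g x ∈ Icc c B) → (∀ x, g' x ∈ Icc c B) →
      (∀ x, g x ≤ g' x) → ∀ x, T g x ≤ T g' x := by
    intro g g' hg hg' hle x
    have := (hs hg x).tsum_le_tsum
      (fun y => mul_le_mul_of_nonneg_left (hle y) (C.offRate_nonneg x y)) (hs hg' x)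
    exact div_le_div_of_nonneg_right
      (by linarith [mul_le_mul_of_nonneg_left this hh.le]) (hD x).le
  -- Starting at the lowest admissible constant makes the iterates increase, so they converge
  -- pointwise; dominated convergence along each row shows that the limit is a fixed point.
  let u : ℕ → X → ℝ := fun m => T^[m] fun _ => c
  have hu1 : ∀ m, u (m + 1) = T (u m) := fun m => Function.iterate_succ_apply' T m _
  have hu : ∀ m x, u m x ∈ Icc c B := by
    intro m
    induction m with
    | zero => exact fun x => ⟨le_rfl, (hf x).1.trans (hf x).2⟩
    | succ m ih => rw [hu1]; exact hT _ ih
  have humono : ∀ m x, u m x ≤ u (m + 1) x := by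
    intro m
    induction m with
    | zero => exact fun x => (hu 1 x).1
    | succ m ih =>
      intro x
      have := hTmono _ _ (hu m) (hu (m + 1)) ih x
      rwa [← hu1, ← hu1] at this
  have hlim : ∀ x, Tendsto (fun m => u m x) atTop (𝓝 (⨆ m, u m x)) := fun x =>
    tendsto_atTop_ciSup (monotone_nat_of_le_succ fun m => humono m x)
      ⟨B, by rintro _ ⟨m, rfl⟩; exact (hu m x).2⟩
  set g : X → ℝ := fun x => ⨆ m, u m x
  have hg : ∀ x, g x ∈ Icc c B := fun x =>
    isClosed_Icc.mem_of_tendsto (hlim x) (Eventually.of_forall fun m => hu m x)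
  refine ⟨g, hg, fun x => ?_⟩
  have hsum : Tendsto (fun m => ∑' y, offRate C.k x y * u m y) atTop
      (𝓝 (∑' y, offRate C.k x y * g y)) := by
    refine tendsto_tsum_of_dominated_convergence ((C.summable_offRate x).mul_right B)
      (fun y => (hlim y).const_mul _) (Eventually.of_forall fun m y => ?_)
    rw [Real.norm_of_nonneg (mul_nonneg (C.offRate_nonneg x y) (hc.trans (hu m y).1))]
    exact mul_le_mul_of_nonneg_left (hu m y).2 (C.offRate_nonneg x y)
  have heq : g x = T g x := by
    refine tendsto_nhds_unique ((tendsto_add_atTop_iff_nat 1).2 (hlim x)) ?_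
    simp only [hu1]
    exact ((hsum.const_mul h).const_add (f x)).div_const _
  have hgen : gen C.k g x = ∑' y, offRate C.k x y * g y - M₁ C.k x * g x := by
    rw [gen_eq_offRate, M₁, ← tsum_mul_right, ← (hs hg x).tsum_sub
      ((C.summable_offRate x).mul_right _)]
    exact tsum_congr fun y => by ring
  rw [eq_div_iff (hD x).ne'] at heq
  rw [hgen]
  linarith

end ReversibleGenerator

/-! ### Convexity of `F₀` and the discrete chain rule for `Φ`. -/

theorem deriv_Upsilon (r : ℝ) : deriv Upsilon r = Real.exp r - 1 := by
  have : HasDerivAt Upsilon (Real.exp r - 1) r :=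
    ((Real.hasDerivAt_exp r).sub (hasDerivAt_id r)).sub_const 1
  exact this.deriv

/-- The tangent to the trivial extension of the power function at a nonnegative point. -/
theorem powerCD_tangent {δ n s : ℝ} (hδ : 0 ≤ δ) (hn : 0 < n) (hs : 0 ≤ s) (r : ℝ) :
    powerCD δ n s + (1 + δ) * s ^ δ / n * (r - s) ≤ trivialExt (powerCD δ n) r := by
  unfold trivialExt
  split_ifs with hr
  · have h := rpow_tangent (by linarith : 1 ≤ 1 + δ) hs hr
    rw [add_sub_cancel_left] at h
    unfold powerCD
    calc _ = (s ^ (1 + δ) + (1 + δ) * s ^ δ * (r - s)) / n := by ring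
      _ ≤ _ := div_le_div_of_nonneg_right h hn.le
  -- For `r < 0` the tangent line lies below its value at `0`, which is `-δ s ^ (1 + δ) / n ≤ 0`.
  · have hsδ : 0 ≤ s ^ δ := Real.rpow_nonneg hs δ
    have e : s ^ (1 + δ) = s * s ^ δ := by
      rcases eq_or_lt_of_le hs with rfl | hs
      · rw [Real.zero_rpow (by linarith), zero_mul]
      · rw [Real.rpow_add hs, Real.rpow_one]
    unfold powerCD
    rw [e]
    have h1 : s * s ^ δ + (1 + δ) * s ^ δ * (r - s) ≤ 0 := by
      have h2 : 0 ≤ δ * (s * s ^ δ) := by positivity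
      have h3 : 0 ≤ (1 + δ) * s ^ δ * (-r) := mul_nonneg (by positivity) (by linarith)
      nlinarith
    calc _ = (s * s ^ δ + (1 + δ) * s ^ δ * (r - s)) / n := by ring
      _ ≤ 0 := div_nonpos_of_nonpos_of_nonneg h1 hn.le

/-- If `Φ'` stayed equal to `Φ'(I)` on the whole increment, the gain would be exactly `h I`. Using
the smaller slope at the right end `J'` costs `O(h²)`, with a constant governed by the bound `K` for
both arguments. -/
theorem extendZero_powerGrowth_step {κ δ n h I J K : ℝ} (hκ : 0 < κ) (hδ : 1 ≤ δ) (hn : 0 < n)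
    (hh : 0 < h) (hI : 0 ≤ I) (hIJ : I + 2 * h * (I * (κ + I ^ δ / n)) ≤ J) (hJ : J ≤ K) :
    extendZero (powerGrowth κ δ n) I + h * I - h ^ 2 * (2 * (δ * K ^ (δ - 1) / n) * K ^ 2) ≤
      extendZero (powerGrowth κ δ n) J := by
  set Φ := extendZero (powerGrowth κ δ n)
  have hmono : MonotoneOn Φ (Ici 0) := monotoneOn_extendZero_powerGrowth hκ hδ hn
  have hgI : 0 < κ + I ^ δ / n := by positivity
  set J' := I + 2 * h * (I * (κ + I ^ δ / n)) with hJ'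
  have hIJ' : I ≤ J' := by
    have : 0 ≤ 2 * h * (I * (κ + I ^ δ / n)) := by positivity
    linarith
  have hJ'0 : 0 ≤ J' := hI.trans hIJ'
  have hK0 : 0 ≤ K := hJ'0.trans (hIJ.trans hJ)
  refine le_trans ?_ (hmono hJ'0 (hJ'0.trans hIJ) hIJ)
  have hΛ : 0 ≤ δ * K ^ (δ - 1) / n :=
    div_nonneg (mul_nonneg (by linarith) (Real.rpow_nonneg hK0 _)) hn.le
  set Λ := δ * K ^ (δ - 1) / n
  rcases eq_or_lt_of_le hI with h0 | hI
  -- For `I = 0` the gain `h I` vanishes and monotonicity suffices.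
  · have := hmono (show I ∈ Ici (0 : ℝ) from hI) hJ'0 hIJ'
    rw [← h0] at this ⊢
    have : 0 ≤ h ^ 2 * (2 * Λ * K ^ 2) := by positivity
    linarith
  have hIJ'' : I < J' := by
    have : 0 < 2 * h * (I * (κ + I ^ δ / n)) := by positivity
    linarith
  obtain ⟨ξ, hξ, hξ'⟩ := exists_hasDerivAt_eq_slope (powerGrowth κ δ n)
    (fun r => 1 / (2 * (κ + r ^ δ / n))) hIJ''
    (fun r hr => (hasDerivAt_powerGrowth hκ hδ hn
      (hI.trans_le hr.1)).continuousAt.continuousWithinAt)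
    (fun r hr => hasDerivAt_powerGrowth hκ hδ hn (hI.trans hr.1))
  rw [eq_div_iff (sub_pos.2 hIJ'').ne'] at hξ'
  have hgJ : 0 < κ + J' ^ δ / n := by positivity
  have hmon : 1 / (2 * (κ + J' ^ δ / n)) ≤ 1 / (2 * (κ + ξ ^ δ / n)) := by
    have hξ0 : 0 < ξ := hI.trans hξ.1
    have := hξ.2.le
    gcongr
  have h1 : 1 / (2 * (κ + J' ^ δ / n)) * (J' - I) ≤
      powerGrowth κ δ n J' - powerGrowth κ δ n I := by
    rw [← hξ']
    exact mul_le_mul_of_nonneg_right hmon (sub_nonneg.2 hIJ')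
  have e : J' - I = 2 * h * (I * (κ + I ^ δ / n)) := by rw [hJ']; ring
  -- `Λ` is a Lipschitz constant of `r ^ δ / n` on `[0, K]`, and `J' - I` is a multiple of `κ + I ^
  -- δ / n`, which therefore factors out.
  have hlip : κ + J' ^ δ / n ≤ (κ + I ^ δ / n) * (1 + 2 * h * Λ * I) := by
    have ht := rpow_tangent hδ hJ'0 hI.le
    have hp : J' ^ (δ - 1) ≤ K ^ (δ - 1) :=
      Real.rpow_le_rpow hJ'0 (hIJ.trans hJ) (by linarith)
    have h2 : J' ^ δ ≤ I ^ δ + δ * K ^ (δ - 1) * (J' - I) := by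
      have := mul_le_mul_of_nonneg_right
        (mul_le_mul_of_nonneg_left hp (by linarith : 0 ≤ δ)) (sub_nonneg.2 hIJ')
      linarith
    have h3 := div_le_div_of_nonneg_right h2 hn.le
    have h4 : (I ^ δ + δ * K ^ (δ - 1) * (J' - I)) / n = I ^ δ / n + Λ * (J' - I) := by
      simp only [Λ]; ring
    rw [h4, e] at h3
    linarith
  have h5 : h * I - h ^ 2 * (2 * Λ * K ^ 2) ≤ 1 / (2 * (κ + J' ^ δ / n)) * (J' - I) := by
    have hIK : I ≤ K := hIJ'.trans (hIJ.trans hJ)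
    have hI2 : I ^ 2 ≤ K ^ 2 := pow_le_pow_left₀ hI.le hIK 2
    have h6 : h * I - h ^ 2 * (2 * Λ * K ^ 2) ≤ h * I * (1 - 2 * h * Λ * I) := by
      have : h ^ 2 * (2 * Λ) * I ^ 2 ≤ h ^ 2 * (2 * Λ) * K ^ 2 :=
        mul_le_mul_of_nonneg_left hI2 (by positivity)
      linarith
    refine h6.trans ?_
    rw [e, show 1 / (2 * (κ + J' ^ δ / n)) * (2 * h * (I * (κ + I ^ δ / n))) =
      h * I * ((κ + I ^ δ / n) / (κ + J' ^ δ / n)) by field_simp]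
    refine mul_le_mul_of_nonneg_left ?_ (by positivity)
    rw [le_div_iff₀ hgJ]
    -- This is `1 / (1 + t) ≥ 1 - t` for `t = 2 h Λ I`; multiplying by `1 - t` needs it nonnegative,
    -- and otherwise the claim is trivial.
    rcases le_total 0 (1 - 2 * h * Λ * I) with h7 | h7
    · refine (mul_le_mul_of_nonneg_left hlip h7).trans ?_
      have : 0 ≤ (κ + I ^ δ / n) * (2 * h * Λ * I) ^ 2 := by positivity
      linarith
    · exact (mul_nonpos_of_nonpos_of_nonneg h7 hgJ.le).trans hgI.le
  simp only [Φ, extendZero_of_pos hI, extendZero_of_pos (hI.trans hIJ'')]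
  linarith

/-! ### Fisher information and entropy in one Euler step. -/

namespace ReversibleGenerator

variable {C : ReversibleGenerator X}

theorem summable_π_tsum {G : X × X → ℝ} (hG : Summable fun p => C.edge p * G p) :
    Summable fun x => C.π x * ∑' y, offRate C.k x y * G (x, y) := by
  refine hG.prod.congr fun x => ?_
  rw [← tsum_mul_left]
  exact tsum_congr fun y => mul_assoc _ _ _

theorem summable_π_mul_of_wt (hM : Summable fun x => M₁ C.k x ^ 2 * C.π x) {φ : X → ℝ}
    (hφ : φ =O[⊤] C.wt) : Summable fun x => C.π x * φ x := by
  refine summable_π_mul hM (hφ.trans (Asymptotics.isBigO_top.2 ⟨1, fun x => ?_⟩))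
  have := C.one_le_wt x
  rw [Real.norm_of_nonneg (by linarith), Real.norm_of_nonneg (mul_self_nonneg _)]
  nlinarith

theorem summable_offRate_mul_of_one {G : X × X → ℝ} (hG : G =O[⊤] fun _ => (1 : ℝ)) (x : X) :
    Summable fun y => offRate C.k x y * G (x, y) := by
  obtain ⟨B, hB⟩ := Asymptotics.isBigO_top.1 hG
  refine Summable.of_norm_bounded ((C.summable_offRate x).mul_right B) fun y => ?_
  rw [norm_mul, Real.norm_of_nonneg (C.offRate_nonneg x y)]
  exact mul_le_mul_of_nonneg_left (by simpa using hB (x, y)) (C.offRate_nonneg x y)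

theorem abs_gen_le {c B : ℝ} (hc : 0 ≤ c) {g : X → ℝ} (hg : ∀ x, g x ∈ Icc c B) (x : X) :
    |gen C.k g x| ≤ B * C.wt x := by
  have hB : 0 ≤ B := hc.trans ((hg x).1.trans (hg x).2)
  rw [gen_eq_offRate]
  have := tsum_of_norm_bounded (f := fun y => offRate C.k x y * (g y - g x))
    ((C.summable_offRate x).mul_right B).hasSum (fun y => by
      rw [norm_mul, Real.norm_of_nonneg (C.offRate_nonneg x y)]
      refine mul_le_mul_of_nonneg_left ?_ (C.offRate_nonneg x y)
      rw [Real.norm_eq_abs, abs_le]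
      constructor <;> linarith [(hg x).1, (hg x).2, (hg y).1, (hg y).2])
  refine this.trans ?_
  rw [tsum_mul_right]
  change M₁ C.k x * B ≤ B * (1 + M₁ C.k x)
  linarith

variable {c B : ℝ} {f g : X → ℝ}

theorem isBigO_one_of_Icc {a b : ℝ} (hg : ∀ x, g x ∈ Icc a b) : g =O[⊤] fun _ => (1 : ℝ) := by
  refine Asymptotics.isBigO_top.2 ⟨|a| + |b|, fun x => ?_⟩
  rw [norm_one, mul_one, Real.norm_eq_abs, abs_le]
  have h1 := neg_abs_le a
  have h2 := le_abs_self b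
  constructor <;> linarith [(hg x).1, (hg x).2, abs_nonneg a, abs_nonneg b]

theorem log_mem_Icc (hc : 0 < c) (hg : ∀ x, g x ∈ Icc c B) (x : X) :
    Real.log (g x) ∈ Icc (Real.log c) (Real.log B) :=
  ⟨Real.log_le_log hc (hg x).1, Real.log_le_log (hc.trans_le (hg x).1) (hg x).2⟩

theorem isBigO_log (hc : 0 < c) (hg : ∀ x, g x ∈ Icc c B) :
    (fun x => Real.log (g x)) =O[⊤] fun _ => (1 : ℝ) :=
  isBigO_one_of_Icc (log_mem_Icc hc hg)

theorem isBigO_inv (hc : 0 < c) (hg : ∀ x, g x ∈ Icc c B) :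
    (fun x => (g x)⁻¹) =O[⊤] fun _ => (1 : ℝ) :=
  isBigO_one_of_Icc (a := 0) (b := c⁻¹) fun x =>
    ⟨inv_nonneg.2 (hc.le.trans (hg x).1), inv_anti₀ hc (hg x).1⟩

variable (C) in
/-- The Fisher information as a real-valued sum over edges. -/
def fisherReal (f : X → ℝ) : ℝ :=
  (1 / 2) * ∑' p : X × X, C.edge p *
    ((f p.2 - f p.1) * (Real.log (f p.2) - Real.log (f p.1)))

theorem sub_mul_log_sub_log_nonneg {a b : ℝ} (ha : 0 < a) (hb : 0 < b) :
    0 ≤ (a - b) * (Real.log a - Real.log b) := by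
  rcases le_total a b with h | h
  · exact mul_nonneg_of_nonpos_of_nonpos (by linarith) (by linarith [Real.log_le_log ha h])
  · exact mul_nonneg (by linarith) (by linarith [Real.log_le_log hb h])

theorem fisherReal_nonneg (hf : ∀ x, 0 < f x) : 0 ≤ C.fisherReal f :=
  mul_nonneg (by norm_num) (tsum_nonneg fun p =>
    mul_nonneg (C.edge_nonneg p) (sub_mul_log_sub_log_nonneg (hf _) (hf _)))

theorem summable_fisherReal (hM : Summable fun x => M₁ C.k x ^ 2 * C.π x) (hc : 0 < c)
    (hg : ∀ x, g x ∈ Icc c B) : Summable fun p : X × X => C.edge p *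
      ((g p.2 - g p.1) * (Real.log (g p.2) - Real.log (g p.1))) := by
  have h1 := isBigO_one_of_Icc hg
  have h2 := isBigO_log hc hg
  exact summable_edge_mul hM (isBigO_wt₂_of_one (isBigO_bdd_mul
    ((isBigO_snd_one h1).sub (isBigO_fst_one h1)) ((isBigO_snd_one h2).sub (isBigO_fst_one h2))))

theorem fisherReal_eq (hM : Summable fun x => M₁ C.k x ^ 2 * C.π x) (hc : 0 < c)
    (hg : ∀ x, g x ∈ Icc c B) :
    C.fisherReal g = -∑' x, C.π x * (Real.log (g x) * gen C.k g x) := by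
  rw [fisherReal, tsum_edge_mul_sub hM (isBigO_one_of_Icc hg)
    (isBigO_wt_of_one (isBigO_log hc hg)) (ψ := fun x => Real.log (g x))]
  ring

theorem fisherReal_eq' (hM : Summable fun x => M₁ C.k x ^ 2 * C.π x) (hc : 0 < c)
    (hg : ∀ x, g x ∈ Icc c B) :
    C.fisherReal g = -∑' x, C.π x * (g x * gen C.k (fun x => Real.log (g x)) x) := by
  rw [fisherReal_eq hM hc hg, tsum_mul_gen_comm hM (isBigO_log hc hg)
    (isBigO_wt_of_one (isBigO_one_of_Icc hg)) (φ := fun x => Real.log (g x))]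

/-- At a difference of logarithms the exponential in `Υ` becomes a quotient of values of `g`. As `L
g` has mean zero, integrating against `g` turns this into the Fisher information. -/
theorem Psi_Upsilon_log (hc : 0 < c) (hg : ∀ x, g x ∈ Icc c B) (x : X) :
    Psi C.k Upsilon (fun x => Real.log (g x)) x =
      (g x)⁻¹ * gen C.k g x - gen C.k (fun x => Real.log (g x)) x := by
  have h1 := isBigO_one_of_Icc hg
  have h2 := isBigO_log hc hg
  have s1 := summable_offRate_mul_of_one (C := C) ((isBigO_snd_one h1).sub (isBigO_fst_one h1)) x
  have s2 := summable_offRate_mul_of_one (C := C) ((isBigO_snd_one h2).sub (isBigO_fst_one h2)) x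
  rw [Psi_eq_offRate _ (by simp [Upsilon]), gen_eq_offRate, gen_eq_offRate, ← tsum_mul_left,
    ← (s1.mul_left _).tsum_sub s2]
  refine tsum_congr fun y => ?_
  have hx : 0 < g x := hc.trans_le (hg x).1
  have hy : 0 < g y := hc.trans_le (hg y).1
  rw [Upsilon, Real.exp_sub, Real.exp_log hx, Real.exp_log hy]
  field_simp
  ring

/-- Up to sign, this function is the `ℓ²(μ)`-gradient of the Fisher information at `g`. -/
theorem isBigO_fisherGradient (hc : 0 < c) (hg : ∀ x, g x ∈ Icc c B) :
    (fun x => gen C.k (fun x => Real.log (g x)) x + (g x)⁻¹ * gen C.k g x) =O[⊤] C.wt :=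
  (isBigO_gen (isBigO_log hc hg)).add
    (isBigO_bdd_mul (isBigO_inv hc hg) (isBigO_gen (isBigO_one_of_Icc hg)))

/-- The Fisher information lies above its tangent at `g`. -/
theorem fisherReal_ge_tangent (hM : Summable fun x => M₁ C.k x ^ 2 * C.π x) (hc : 0 < c)
    (hf : ∀ x, f x ∈ Icc c B) (hg : ∀ x, g x ∈ Icc c B) :
    -∑' x, C.π x * (f x * (gen C.k (fun x => Real.log (g x)) x + (g x)⁻¹ * gen C.k g x)) ≤
      C.fisherReal f := by
  have g0 : ∀ x, 0 < g x := fun x => hc.trans_le (hg x).1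
  have f0 : ∀ x, 0 < f x := fun x => hc.trans_le (hf x).1
  have h1 := isBigO_one_of_Icc hg
  have h2 := isBigO_log hc hg
  have h3 := isBigO_inv hc hg
  have hf1 := isBigO_one_of_Icc hf
  -- The tangent plane on the edge `p` is `-(G p + G p.swap)`, without constant term since `(a - b)
  -- (log a - log b)` is homogeneous of degree one. Both halves have the same edge sum.
  set G : X × X → ℝ := fun p =>
    f p.1 * ((Real.log (g p.2) - Real.log (g p.1)) + (g p.1)⁻¹ * (g p.2 - g p.1)) with hGdef
  have hG1 : G =O[⊤] fun _ => (1 : ℝ) :=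
    isBigO_bdd_mul (isBigO_fst_one hf1) (((isBigO_snd_one h2).sub (isBigO_fst_one h2)).add
      (isBigO_bdd_mul (isBigO_fst_one h3) ((isBigO_snd_one h1).sub (isBigO_fst_one h1))))
  have hGs := summable_edge_mul hM (isBigO_wt₂_of_one (C := C) hG1)
  have hGs' : Summable fun p : X × X => C.edge p * G p.swap := by
    refine ((Equiv.prodComm X X).summable_iff.2 hGs).congr fun p => ?_
    simp [Function.comp, C.edge_swap]
  have e1 : ∑' p, C.edge p * G p =
      ∑' x, C.π x * (f x * (gen C.k (fun x => Real.log (g x)) x + (g x)⁻¹ * gen C.k g x)) := by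
    rw [tsum_edge hGs]
    refine tsum_congr fun x => ?_
    have s1 := summable_offRate_mul_of_one (C := C) ((isBigO_snd_one h1).sub (isBigO_fst_one h1)) x
    have s2 := summable_offRate_mul_of_one (C := C) ((isBigO_snd_one h2).sub (isBigO_fst_one h2)) x
    rw [gen_eq_offRate, gen_eq_offRate, ← tsum_mul_left (a := (g x)⁻¹),
      ← s2.tsum_add (s1.mul_left _), ← tsum_mul_left (a := f x)]
    congr 1
    refine tsum_congr fun y => ?_
    simp only [hGdef]
    ring
  have e2 : -(2 * ∑' p, C.edge p * G p) ≤ 2 * C.fisherReal f := by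
    have hswap := tsum_edge_swap (C := C) G
    rw [two_mul, fisherReal]
    nth_rewrite 1 [← hswap]
    rw [← hGs'.tsum_add hGs, ← tsum_neg, ← mul_assoc, mul_one_div_cancel two_ne_zero, one_mul]
    refine (hGs'.add hGs).neg.tsum_le_tsum (fun p => ?_) (summable_fisherReal hM hc hf)
    have ht := mul_le_mul_of_nonneg_left
      (log_sub_mul_tangent (g0 p.2) (g0 p.1) (f0 p.2) (f0 p.1)) (C.edge_nonneg p)
    refine le_trans (le_of_eq ?_) ht
    have hg1 := (g0 p.1).ne'
    have hg2 := (g0 p.2).ne'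
    simp only [hGdef, Prod.fst_swap, Prod.snd_swap]
    field_simp
    ring
  rw [← e1]
  linarith

/-- The integrated second-order identity. -/
theorem hasSum_mul_Psi2_log (hM : Summable fun x => M₁ C.k x ^ 2 * C.π x) (hc : 0 < c)
    (hg : ∀ x, g x ∈ Icc c B) :
    HasSum (fun x => C.π x * (g x * (2 * Psi2 C.k Upsilon (fun x => Real.log (g x)) x)))
      (∑' x, C.π x * (gen C.k g x *
        (gen C.k (fun x => Real.log (g x)) x + (g x)⁻¹ * gen C.k g x))) := by
  have g0 : ∀ x, 0 < g x := fun x => hc.trans_le (hg x).1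
  have h1 := isBigO_one_of_Icc hg
  have h2 := isBigO_log hc hg
  have h3 := isBigO_inv hc hg
  set u : X → ℝ := fun x => Real.log (g x) with hu
  set ψ : X → ℝ := Psi C.k Upsilon u with hψdef
  have hψeq : ∀ x, ψ x = (g x)⁻¹ * gen C.k g x - gen C.k u x := Psi_Upsilon_log hc hg
  have hψ : ψ =O[⊤] C.wt :=
    ((isBigO_bdd_mul h3 (isBigO_gen h1)).sub (isBigO_gen h2)).congr_left fun x => (hψeq x).symm
  have hs1 : Summable fun p : X × X => C.edge p * (g p.1 * (ψ p.2 - ψ p.1)) :=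
    summable_edge_mul hM (isBigO_bdd_mul (isBigO_fst_one h1) ((isBigO_snd hψ).sub (isBigO_fst hψ)))
  have hLu : gen C.k u =O[⊤] C.wt := isBigO_gen h2
  have hLg : gen C.k g =O[⊤] C.wt := isBigO_gen h1
  have hs2 : Summable fun p : X × X => C.edge p *
      ((g p.2 - g p.1) * (gen C.k u p.2 - gen C.k u p.1)) :=
    summable_edge_mul hM (isBigO_bdd_mul ((isBigO_snd_one h1).sub (isBigO_fst_one h1))
      ((isBigO_snd hLu).sub (isBigO_fst hLu)))
  -- Multiplication by `g x` turns `Υ'(log g(y) - log g(x))` into `g y - g x`, so Green's formula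
  -- becomes applicable.
  have hB : ∀ x, g x * Bform C.k (deriv Upsilon) u (gen C.k u) x =
      ∑' y, offRate C.k x y * ((g y - g x) * (gen C.k u y - gen C.k u x)) := by
    intro x
    rw [Bform_eq_offRate, ← tsum_mul_left]
    refine tsum_congr fun y => ?_
    rw [deriv_Upsilon, Real.exp_sub, Real.exp_log (g0 x), Real.exp_log (g0 y)]
    have := (g0 x).ne'
    field_simp
  have hA : ∀ x, g x * gen C.k ψ x = ∑' y, offRate C.k x y * (g x * (ψ y - ψ x)) := by
    intro x
    rw [gen_eq_offRate, ← tsum_mul_left]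
    exact tsum_congr fun y => by ring
  have t1 := summable_π_tsum hs1
  have t2 := summable_π_tsum hs2
  -- The first term integrates to `∫ ψ L g` with `ψ = L g / g - L u`, the second to `-2 ∫ L u L g`;
  -- their difference is the left side.
  have key : ∑' x, C.π x * (gen C.k g x * (gen C.k u x + (g x)⁻¹ * gen C.k g x)) =
      ∑' x, C.π x * (g x * gen C.k ψ x) -
        ∑' p : X × X, C.edge p * ((g p.2 - g p.1) * (gen C.k u p.2 - gen C.k u p.1)) := by
    rw [tsum_mul_gen_comm hM h1 hψ, tsum_edge_mul_sub hM h1 hLu]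
    have q1 : Summable fun x => C.π x * (ψ x * gen C.k g x) := summable_π_mul hM (hψ.mul hLg)
    have q2 : Summable fun x => C.π x * (gen C.k u x * gen C.k g x) :=
      summable_π_mul hM (hLu.mul hLg)
    rw [neg_mul, sub_neg_eq_add, ← tsum_mul_left, ← q1.tsum_add (q2.mul_left 2)]
    refine tsum_congr fun x => ?_
    rw [hψeq]
    ring
  rw [key, tsum_edge hs2]
  have t1' : Summable fun x => C.π x * (g x * gen C.k ψ x) := t1.congr fun x => by rw [hA]
  refine (t1'.hasSum.sub t2.hasSum).congr_fun fun x => ?_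
  dsimp only
  rw [← hB, Psi2]
  ring

/-- One implicit Euler step decreases the Fisher information. -/
theorem fisherReal_step (hM : Summable fun x => M₁ C.k x ^ 2 * C.π x) {κ δ n h : ℝ}
    (hδ : 0 ≤ δ) (hn : 0 < n) (hCD : CDUpsilon C.k κ (powerCD δ n)) (hh : 0 < h) (hc : 0 < c)
    (hf : ∀ x, f x ∈ Icc c B) (hg : ∀ x, g x ∈ Icc c B)
    (hfg : ∀ x, g x = f x + h * gen C.k g x) (hg1 : HasSum (fun x => g x * C.π x) 1) :
    C.fisherReal g + 2 * h * (κ * C.fisherReal g + powerCD δ n (C.fisherReal g)) ≤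
      C.fisherReal f := by
  have g0 : ∀ x, 0 < g x := fun x => hc.trans_le (hg x).1
  have h1 := isBigO_one_of_Icc hg
  have h2 := isBigO_log hc hg
  have hLg : gen C.k g =O[⊤] C.wt := isBigO_gen h1
  have hR := isBigO_fisherGradient (C := C) hc hg
  have hJ0 : 0 ≤ C.fisherReal g := fisherReal_nonneg g0
  have hJ := fisherReal_eq' (C := C) hM hc hg
  have htan := fisherReal_ge_tangent (C := C) hM hc hf hg
  have hΨ := hasSum_mul_Psi2_log (C := C) hM hc hg
  have hbdd : ∃ A, ∀ x, |Real.log (g x)| ≤ A := by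
    obtain ⟨A, hA⟩ := Asymptotics.isBigO_top.1 h2
    exact ⟨A, fun x => by simpa using hA x⟩
  set u : X → ℝ := fun x => Real.log (g x) with hu
  set R : X → ℝ := fun x => gen C.k u x + (g x)⁻¹ * gen C.k g x with hRdef
  set J := C.fisherReal g
  have hLu : gen C.k u =O[⊤] C.wt := isBigO_gen h2
  have s1 : Summable fun x => C.π x * (g x * gen C.k u x) :=
    summable_π_mul_of_wt hM (isBigO_bdd_mul h1 hLu)
  have s2 : Summable fun x => C.π x * gen C.k g x := summable_π_mul_of_wt hM hLg
  have s3 : Summable fun x => C.π x * (gen C.k g x * R x) := summable_π_mul hM (hLg.mul hR)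
  have z2 : ∑' x, C.π x * gen C.k g x = 0 := tsum_gen_eq_zero hM h1
  have hs1 : HasSum (fun x => C.π x * (g x * gen C.k u x)) (-J) := by
    rw [hJ, neg_neg]
    exact s1.hasSum
  have hs2 : HasSum (fun x => C.π x * gen C.k g x) 0 := z2 ▸ s2.hasSum
  -- Here `f = g - h L g` and `∫ g R = ∫ g L u + ∫ L g = -J`. The remaining term is `-2h ∫ g
  -- Ψ_{2,Υ}(u)` by the second-order identity.
  have e1 : ∑' x, C.π x * (f x * R x) = -J - h * ∑' x, C.π x * (gen C.k g x * R x) := by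
    have := (hs1.add hs2).sub (s3.hasSum.mul_left h)
    rw [add_zero] at this
    rw [← this.tsum_eq]
    refine tsum_congr fun x => ?_
    have hx := (g0 x).ne'
    have : f x = g x - h * gen C.k g x := by linarith [hfg x]
    rw [this, hRdef]
    field_simp
  -- Jensen's inequality for the probability density `g`: `F₀` is replaced by its tangent at the
  -- mean `J` of `-L u`, so the linear term cancels and no integrability of `F₀(-L u)` is needed.
  have hlow : HasSum (fun x => 2 * (κ * (C.π x * gen C.k g x - C.π x * (g x * gen C.k u x)) +
      (powerCD δ n J * (g x * C.π x) + (1 + δ) * J ^ δ / n *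
        (-(C.π x * (g x * gen C.k u x)) - J * (g x * C.π x)))))
      (2 * (κ * (0 - -J) + (powerCD δ n J * 1 + (1 + δ) * J ^ δ / n * (-(-J) - J * 1)))) :=
    (((hs2.sub hs1).mul_left κ).add ((hg1.mul_left _).add
      ((hs1.neg.sub (hg1.mul_left J)).mul_left _))).mul_left 2
  have hle := hasSum_le (fun x => ?_) hlow hΨ
  · have h4 := mul_le_mul_of_nonneg_left hle hh.le
    have h5 : -J - h * ∑' x, C.π x * (gen C.k g x * R x) ≥ -C.fisherReal f := by
      rw [← e1]
      linarith
    have h6 : ∑' x, C.π x * (gen C.k g x * (gen C.k (fun x => Real.log (g x)) x +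
      (g x)⁻¹ * gen C.k g x)) = ∑' x, C.π x * (gen C.k g x * R x) := rfl
    rw [h6] at h4
    linarith
  · have hcd := hCD.2 u hbdd x
    have htg := powerCD_tangent hδ hn hJ0 (-gen C.k u x)
    rw [Psi_Upsilon_log hc hg x] at hcd
    have hw : 0 ≤ 2 * (g x * C.π x) := by have := g0 x; have := C.π_pos x; positivity
    have h7 := mul_le_mul_of_nonneg_left ((add_le_add_right htg
      (κ * ((g x)⁻¹ * gen C.k g x - gen C.k u x))).trans hcd) hw
    have hx := (g0 x).ne'
    have h8 : (2 * (g x * C.π x)) * (κ * ((g x)⁻¹ * gen C.k g x - gen C.k u x)) =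
        2 * (κ * (C.π x * gen C.k g x - C.π x * (g x * gen C.k u x))) := by
      field_simp
    rw [mul_add, h8] at h7
    linarith

theorem hasSum_step (hM : Summable fun x => M₁ C.k x ^ 2 * C.π x) {h a : ℝ}
    (hg : ∀ x, g x ∈ Icc c B) (hfg : ∀ x, g x = f x + h * gen C.k g x)
    (hf1 : HasSum (fun x => f x * C.π x) a) : HasSum (fun x => g x * C.π x) a := by
  have h1 := isBigO_one_of_Icc hg
  have hs : HasSum (fun x => C.π x * gen C.k g x) 0 :=
    tsum_gen_eq_zero hM h1 ▸ (summable_π_mul_of_wt hM (isBigO_gen h1)).hasSum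
  have := hf1.add (hs.mul_left h)
  rw [mul_zero, add_zero] at this
  refine this.congr_fun fun x => ?_
  rw [hfg x]
  ring

/-- The entropy dissipation in one implicit Euler step. -/
theorem entropy_step (hM : Summable fun x => M₁ C.k x ^ 2 * C.π x) {h : ℝ} (hc : 0 < c)
    (hf : ∀ x, f x ∈ Icc c B) (hg : ∀ x, g x ∈ Icc c B)
    (hfg : ∀ x, g x = f x + h * gen C.k g x) :
    ∑' x, C.π x * (f x * Real.log (f x)) - ∑' x, C.π x * (g x * Real.log (g x)) ≤
      h * C.fisherReal g + h ^ 2 * (B ^ 2 / c * ∑' x, C.wt x ^ 2 * C.π x) := by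
  have h1 := isBigO_one_of_Icc hg
  have h2 := isBigO_log hc hg
  have hLg : gen C.k g =O[⊤] C.wt := isBigO_gen h1
  have s1 : Summable fun x => C.π x * (f x * Real.log (f x)) :=
    summable_π_mul_of_wt hM (isBigO_wt_of_one
      (isBigO_bdd_mul (isBigO_one_of_Icc hf) (isBigO_log hc hf)))
  have s2 : Summable fun x => C.π x * (g x * Real.log (g x)) :=
    summable_π_mul_of_wt hM (isBigO_wt_of_one (isBigO_bdd_mul h1 h2))
  have hs : HasSum (fun x => C.π x * gen C.k g x) 0 :=
    tsum_gen_eq_zero hM h1 ▸ (summable_π_mul_of_wt hM hLg).hasSum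
  have hs3 : HasSum (fun x => C.π x * (Real.log (g x) * gen C.k g x)) (-C.fisherReal g) := by
    rw [fisherReal_eq hM hc hg, neg_neg]
    exact (summable_π_mul_of_wt hM (isBigO_bdd_mul h2 hLg)).hasSum
  have hs4 := ((summable_wt_sq hM).hasSum.mul_left (B ^ 2 / c)).mul_left (h ^ 2)
  have hR := ((hs.add hs3).mul_left (-h)).add hs4
  have hle := hasSum_le (fun x => ?_) (s1.hasSum.sub s2.hasSum) hR
  · linarith
  · have f0 : 0 < f x := hc.trans_le (hf x).1
    have g0 : 0 < g x := hc.trans_le (hg x).1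
    have t1 := mul_log_tangent f0 g0
    have t2 := log_sub_log_mul_le hc (hf x).1 (hg x).1
    have e : f x - g x = -(h * gen C.k g x) := by linarith [hfg x]
    have t3 : (f x - g x) ^ 2 / c ≤ h ^ 2 * (B ^ 2 / c * C.wt x ^ 2) := by
      have := abs_gen_le (C := C) hc.le hg x
      have h5 : gen C.k g x ^ 2 ≤ (B * C.wt x) ^ 2 := by
        rw [← sq_abs]
        exact pow_le_pow_left₀ (abs_nonneg _) this 2
      rw [e]
      calc (-(h * gen C.k g x)) ^ 2 / c = h ^ 2 / c * gen C.k g x ^ 2 := by ring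
        _ ≤ h ^ 2 / c * (B * C.wt x) ^ 2 := mul_le_mul_of_nonneg_left h5 (by positivity)
        _ = _ := by ring
    have t4 : f x * Real.log (f x) - g x * Real.log (g x) ≤
        -h * (gen C.k g x + Real.log (g x) * gen C.k g x) +
          h ^ 2 * (B ^ 2 / c * C.wt x ^ 2) := by
      -- Replacing `log f` by `log g` isolates a quadratic error. What is left integrates to `h`
      -- times the Fisher information of `g`.
      have e2 : (Real.log (f x) + 1) * (f x - g x) =
          (Real.log (f x) - Real.log (g x)) * (f x - g x) + Real.log (g x) * (f x - g x) +
            (f x - g x) := by ring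
      rw [e2] at t1
      have e3 : Real.log (g x) * (f x - g x) = -(h * (Real.log (g x) * gen C.k g x)) := by
        rw [e]; ring
      linarith
    have := mul_le_mul_of_nonneg_left t4 (C.π_pos x).le
    linarith

end ReversibleGenerator

/-! ### Inequalities for the long-time limit and for truncation. -/

/-- The logarithm has slope at least `1/B` on `(0, B]`. Thus small Fisher information forces small
differences across edges. -/
theorem sq_sub_le_mul_log {a b B : ℝ} (ha : 0 < a) (hb : 0 < b) (haB : a ≤ B) (hbB : b ≤ B) :
    (a - b) ^ 2 ≤ B * ((a - b) * (Real.log a - Real.log b)) := by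
  have key : ∀ {a b : ℝ}, 0 < a → 0 < b → a ≤ B → b ≤ a →
      (a - b) ^ 2 ≤ B * ((a - b) * (Real.log a - Real.log b)) := by
    intro a b ha hb haB hab
    have h := Real.log_le_sub_one_of_pos (div_pos hb ha)
    rw [Real.log_div hb.ne' ha.ne'] at h
    have h2 : a - b ≤ a * (Real.log a - Real.log b) := by
      have := mul_le_mul_of_nonneg_left h ha.le
      have e : a * (b / a - 1) = b - a := by field_simp
      linarith
    have h3 : a * (Real.log a - Real.log b) ≤ B * (Real.log a - Real.log b) :=
      mul_le_mul_of_nonneg_right haB (sub_nonneg.2 (Real.log_le_log hb hab))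
    have := mul_le_mul_of_nonneg_left (h2.trans h3) (sub_nonneg.2 hab)
    linarith
  rcases le_total b a with h | h
  · exact key ha hb haB h
  · have := key hb ha hbB h
    linarith

/-- Truncation of a real number to the interval `[ε, M]`. -/
def clamp (ε M a : ℝ) : ℝ := min (max a ε) M

theorem clamp_mem_Icc {ε M : ℝ} (h : ε ≤ M) (a : ℝ) : clamp ε M a ∈ Icc ε M :=
  ⟨le_min (le_max_right _ _) h, min_le_right _ _⟩

theorem clamp_sub_le {ε M a b : ℝ} (hab : b ≤ a) : clamp ε M a - clamp ε M b ≤ a - b := by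
  simp only [clamp, min_def, max_def]
  split_ifs <;> linarith

theorem clamp_mono (ε M : ℝ) : Monotone (clamp ε M) := fun _ _ h =>
  min_le_min_right _ (max_le_max_right _ h)

theorem clamp_of_mem {ε M a : ℝ} (h : a ∈ Icc ε M) : clamp ε M a = a := by
  rw [clamp, max_eq_left h.1, min_eq_left h.2]

theorem log_clamp {ε M a : ℝ} (hε : 0 < ε) (hM : 0 < M) (ha : 0 < a) :
    Real.log (clamp ε M a) = clamp (Real.log ε) (Real.log M) (Real.log a) := by
  have hm := Real.strictMonoOn_log.monotoneOn
  rw [clamp, clamp, hm.map_min (show max a ε ∈ Ioi 0 from lt_max_of_lt_left ha) hM,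
    hm.map_max ha hε]

/-- Truncation is monotone and 1-Lipschitz, and on the logarithmic scale it is again a truncation,
so both factors shrink without changing sign. -/
theorem clamp_mul_log_le {ε M a b : ℝ} (hε : 0 < ε) (hM : 0 < M) (ha : 0 < a) (hb : 0 < b) :
    (clamp ε M a - clamp ε M b) * (Real.log (clamp ε M a) - Real.log (clamp ε M b)) ≤
      (a - b) * (Real.log a - Real.log b) := by
  have key : ∀ {a b : ℝ}, 0 < a → 0 < b → b ≤ a →
      (clamp ε M a - clamp ε M b) * (Real.log (clamp ε M a) - Real.log (clamp ε M b)) ≤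
        (a - b) * (Real.log a - Real.log b) := by
    intro a b ha hb hab
    rw [log_clamp hε hM ha, log_clamp hε hM hb]
    have hl := Real.log_le_log hb hab
    exact mul_le_mul (clamp_sub_le hab) (clamp_sub_le hl)
      (sub_nonneg.2 (clamp_mono _ _ hl)) (sub_nonneg.2 hab)
  rcases le_total b a with h | h
  · exact key ha hb h
  · have := key hb ha h
    linarith

/-- A dominating function uniform in the truncation: `|t log t|` is at most `1` for `t ≤ 1`, and a
truncated value above `1` is at most `a`, where `t log t` is increasing. -/
theorem abs_clamp_mul_log_le {ε M a : ℝ} (hε : 0 < ε) (hε1 : ε ≤ 1) (hM : ε ≤ M) :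
    |clamp ε M a * Real.log (clamp ε M a)| ≤ |a * Real.log a| + 1 := by
  have h0 : 0 < clamp ε M a := hε.trans_le (clamp_mem_Icc hM a).1
  rcases le_or_gt (clamp ε M a) 1 with h | h
  · have := Real.abs_log_mul_self_lt _ h0 h
    rw [mul_comm] at this
    linarith [abs_nonneg (a * Real.log a)]
  · have h1 : 1 < max a ε := lt_of_lt_of_le h (min_le_left _ _)
    have ha1 : 1 < a := (lt_max_iff.1 h1).resolve_right (not_lt.2 hε1)
    have hle : clamp ε M a ≤ a :=
      (min_le_left _ _).trans_eq (max_eq_left (hε1.trans ha1.le))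
    rw [abs_of_nonneg (mul_nonneg h0.le (Real.log_nonneg h.le)),
      abs_of_nonneg (mul_nonneg (by linarith) (Real.log_nonneg ha1.le))]
    have := mul_le_mul hle (Real.log_le_log h0 hle) (Real.log_nonneg h.le) (by linarith)
    linarith

/-! ### Long-time limit and the inequality for bounded densities. -/

namespace ReversibleGenerator

variable {C : ReversibleGenerator X} {c B : ℝ} {f : X → ℝ}

theorem edge_pos {x y : X} (hxy : x ≠ y) (hk : 0 < C.k x y) : 0 < C.edge (x, y) := by
  simp only [edge, offRate, if_neg hxy.symm]
  exact mul_pos (C.π_pos x) hk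

/-- Bounded densities with vanishing Fisher information have vanishing entropy. -/
theorem tendsto_entropy_zero (hM : Summable fun x => M₁ C.k x ^ 2 * C.π x) (hc : 0 < c)
    {g : ℕ → X → ℝ} (hg : ∀ m x, g m x ∈ Icc c B)
    (hg1 : ∀ m, HasSum (fun x => g m x * C.π x) 1)
    (hJ : Tendsto (fun m => C.fisherReal (g m)) atTop (𝓝 0)) :
    Tendsto (fun m => ∑' x, C.π x * (g m x * Real.log (g m x))) atTop (𝓝 0) := by
  have g0 : ∀ m x, 0 < g m x := fun m x => hc.trans_le (hg m x).1
  have hedge : ∀ x y, x ≠ y ∧ 0 < C.k x y →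
      Tendsto (fun m => g m y - g m x) atTop (𝓝 0) := by
    rintro x y ⟨hxy, hk⟩
    have he := edge_pos hxy hk
    have hB : 0 ≤ B := hc.le.trans ((hg 0 x).1.trans (hg 0 x).2)
    have hbound : ∀ m, (g m y - g m x) ^ 2 ≤ B / C.edge (x, y) * (2 * C.fisherReal (g m)) := by
      intro m
      have h1 := sq_sub_le_mul_log (g0 m y) (g0 m x) (hg m y).2 (hg m x).2
      have h2 := (summable_fisherReal hM hc (hg m)).le_tsum (x, y) fun p _ =>
        mul_nonneg (C.edge_nonneg p) (sub_mul_log_sub_log_nonneg (g0 m _) (g0 m _))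
      have h3 : ∑' p : X × X, C.edge p * ((g m p.2 - g m p.1) *
          (Real.log (g m p.2) - Real.log (g m p.1))) = 2 * C.fisherReal (g m) := by
        rw [fisherReal]; ring
      rw [h3] at h2
      rw [div_mul_eq_mul_div, le_div_iff₀ he]
      have h4 := mul_le_mul_of_nonneg_left h2 hB
      have h5 := mul_le_mul_of_nonneg_right h1 he.le
      simp only at h4
      linarith
    have hlim : Tendsto (fun m => B / C.edge (x, y) * (2 * C.fisherReal (g m))) atTop (𝓝 0) := by
      simpa using (hJ.const_mul 2).const_mul (B / C.edge (x, y))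
    have hsq := squeeze_zero (fun m => sq_nonneg (g m y - g m x)) hbound hlim
    have := hsq.sqrt
    simp only [Real.sqrt_sq_eq_abs, Real.sqrt_zero] at this
    exact (tendsto_zero_iff_abs_tendsto_zero _).2 this
  -- Irreducibility joins any two states by finitely many edges, along which the differences
  -- telescope.
  have hall : ∀ x y, Tendsto (fun m => g m y - g m x) atTop (𝓝 0) := by
    intro x y
    induction C.irreducible x y with
    | refl => simp
    | tail _ hbc ih =>
      have := ih.add (hedge _ _ hbc)
      rw [add_zero] at this
      exact this.congr fun m => by ring
  have hpt : ∀ x, Tendsto (fun m => g m x) atTop (𝓝 1) := by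
    intro x
    have hsum : Tendsto (fun m => ∑' y, (g m y - g m x) * C.π y) atTop
        (𝓝 (∑' _ : X, (0 : ℝ))) := by
      refine tendsto_tsum_of_dominated_convergence (C.π_sum.summable.mul_left B)
        (fun y => ?_) (Eventually.of_forall fun m y => ?_)
      · simpa using (hall x y).mul_const (C.π y)
      · rw [norm_mul, Real.norm_of_nonneg (C.π_pos y).le, Real.norm_eq_abs]
        refine mul_le_mul_of_nonneg_right ?_ (C.π_pos y).le
        rw [abs_le]
        constructor <;> linarith [(hg m x).1, (hg m x).2, (hg m y).1, (hg m y).2]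
    -- Unit mass identifies the limiting constant as `1`.
    have heq : ∀ m, ∑' y, (g m y - g m x) * C.π y = 1 - g m x := by
      intro m
      have := (hg1 m).sub (C.π_sum.mul_left (g m x))
      rw [mul_one] at this
      rw [← this.tsum_eq]
      exact tsum_congr fun y => by ring
    simp only [heq, tsum_zero] at hsum
    simpa using hsum.const_sub 1
  have hlim : Tendsto (fun m => ∑' x, C.π x * (g m x * Real.log (g m x))) atTop
      (𝓝 (∑' x, C.π x * (1 * Real.log 1))) := by
    refine tendsto_tsum_of_dominated_convergence
      (C.π_sum.summable.mul_right (B * (|Real.log c| + |Real.log B|)))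
      (fun x => ?_) (Eventually.of_forall fun m x => ?_)
    · exact ((hpt x).mul ((Real.continuousAt_log one_ne_zero).tendsto.comp (hpt x))).const_mul _
    · rw [norm_mul, norm_mul, Real.norm_of_nonneg (C.π_pos x).le, Real.norm_of_nonneg (g0 m x).le]
      refine mul_le_mul_of_nonneg_left (mul_le_mul (hg m x).2 ?_ (norm_nonneg _)
        ((g0 m x).le.trans (hg m x).2)) (C.π_pos x).le
      have h1 := neg_abs_le (Real.log c)
      have h2 := le_abs_self (Real.log B)
      have h3 := log_mem_Icc hc (hg m) x
      rw [Real.norm_eq_abs, abs_le]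
      constructor <;> linarith [h3.1, h3.2, abs_nonneg (Real.log c), abs_nonneg (Real.log B)]
  simpa using hlim

/-- The state of the implicit Euler scheme after `N` steps of size `h`. -/
theorem exists_euler_scheme (hM : Summable fun x => M₁ C.k x ^ 2 * C.π x) {κ δ n h : ℝ}
    (hκ : 0 < κ) (hδ : 1 ≤ δ) (hn : 0 < n) (hCD : CDUpsilon C.k κ (powerCD δ n)) (hh : 0 < h)
    (hc : 0 < c) (hf : ∀ x, f x ∈ Icc c B) (hf1 : HasSum (fun x => f x * C.π x) 1) (N : ℕ) :
    ∃ g : X → ℝ, (∀ x, g x ∈ Icc c B) ∧ HasSum (fun x => g x * C.π x) 1 ∧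
      C.fisherReal g * (1 + 2 * h * κ) ^ N ≤ C.fisherReal f ∧
      ∑' x, C.π x * (f x * Real.log (f x)) - ∑' x, C.π x * (g x * Real.log (g x)) ≤
        extendZero (powerGrowth κ δ n) (C.fisherReal f) -
          extendZero (powerGrowth κ δ n) (C.fisherReal g) +
          N * h ^ 2 * (2 * (δ * C.fisherReal f ^ (δ - 1) / n) * C.fisherReal f ^ 2 +
            B ^ 2 / c * ∑' x, C.wt x ^ 2 * C.π x) := by
  induction N with
  | zero => exact ⟨f, hf, hf1, by simp, by simp⟩
  | succ N ih =>
    obtain ⟨g, hg, hg1, hJ, hE⟩ := ih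
    obtain ⟨g', hg', hgg'⟩ := exists_resolvent C hh hc.le hg
    have hg'1 := hasSum_step hM hg' hgg' hg1
    have hstep := fisherReal_step hM (by linarith) hn hCD hh hc hg hg' hgg' hg'1
    have hent := entropy_step hM hc hg hg' hgg'
    have hJ0 : 0 ≤ C.fisherReal g' := fisherReal_nonneg fun x => hc.trans_le (hg' x).1
    have hJg0 : 0 ≤ C.fisherReal g := fisherReal_nonneg fun x => hc.trans_le (hg x).1
    have hF : 0 ≤ powerCD δ n (C.fisherReal g') := hCD.1.nonneg _ hJ0
    have hpow : 1 ≤ (1 + 2 * h * κ) ^ N := one_le_pow₀ (by nlinarith [mul_pos hh hκ])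
    have hJf : C.fisherReal g ≤ C.fisherReal f :=
      (le_mul_of_one_le_right hJg0 hpow).trans hJ
    have hstep' : C.fisherReal g' + 2 * h * (C.fisherReal g' *
        (κ + C.fisherReal g' ^ δ / n)) ≤ C.fisherReal g := by
      refine le_trans (le_of_eq ?_) hstep
      rw [powerCD, Real.rpow_add_of_nonneg hJ0 zero_le_one (by linarith), Real.rpow_one]
      ring
    -- The initial Fisher information serves as the bound `K`, so the error constant is the same in
    -- all steps.
    have hΦ := extendZero_powerGrowth_step hκ hδ hn hh hJ0 hstep' hJf
    refine ⟨g', hg', hg'1, ?_, ?_⟩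
    · have h1 : C.fisherReal g' * (1 + 2 * h * κ) ≤ C.fisherReal g := by
        have := mul_nonneg (mul_nonneg zero_le_two hh.le) hF
        linarith
      calc _ = C.fisherReal g' * (1 + 2 * h * κ) * (1 + 2 * h * κ) ^ N := by ring
        _ ≤ C.fisherReal g * (1 + 2 * h * κ) ^ N :=
            mul_le_mul_of_nonneg_right h1 (by linarith)
        _ ≤ _ := hJ
    · push_cast
      linarith

/-- The entropy-information inequality for densities bounded above and away from zero. -/
theorem entropy_le_of_bounded (hM : Summable fun x => M₁ C.k x ^ 2 * C.π x) {κ δ n : ℝ}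
    (hκ : 0 < κ) (hδ : 1 ≤ δ) (hn : 0 < n) (hCD : CDUpsilon C.k κ (powerCD δ n))
    (hc : 0 < c) (hf : ∀ x, f x ∈ Icc c B) (hf1 : HasSum (fun x => f x * C.π x) 1) :
    ∑' x, C.π x * (f x * Real.log (f x)) ≤
      extendZero (powerGrowth κ δ n) (C.fisherReal f) := by
  have hm0 : ∀ m : ℕ, (0 : ℝ) < m + 1 := fun m => by positivity
  have hpos : ∀ m : ℕ, (0 : ℝ) < 1 / ((m : ℝ) + 1) ^ 2 := fun m => by positivity
  -- With `h = (m + 1)⁻²` and `N = (m + 1)³` the total time `N h = m + 1` tends to infinity while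
  -- the accumulated error is proportional to `N h² = 1 / (m + 1)`.
  choose g hg hg1 hJ hE using fun m : ℕ =>
    exists_euler_scheme hM hκ hδ hn hCD (hpos m) hc hf hf1 ((m + 1) ^ 3)
  set D := 2 * (δ * C.fisherReal f ^ (δ - 1) / n) * C.fisherReal f ^ 2 +
    B ^ 2 / c * ∑' x, C.wt x ^ 2 * C.π x
  have hg0 : ∀ m, 0 ≤ C.fisherReal (g m) := fun m =>
    fisherReal_nonneg fun x => hc.trans_le (hg m x).1
  have hJ' : ∀ m : ℕ, C.fisherReal (g m) ≤ C.fisherReal f / (1 + 2 * κ * (m + 1)) := by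
    intro m
    have hd : 0 < 1 + 2 * κ * ((m : ℝ) + 1) := by have := hm0 m; positivity
    rw [le_div_iff₀ hd]
    refine le_trans (mul_le_mul_of_nonneg_left ?_ (hg0 m)) (hJ m)
    -- Bernoulli's inequality: decay linear in the total time is enough.
    have hb := one_add_mul_le_pow (a := 2 * (1 / ((m : ℝ) + 1) ^ 2) * κ)
      (by have : 0 ≤ 2 * (1 / ((m : ℝ) + 1) ^ 2) * κ := by positivity
          linarith) ((m + 1) ^ 3)
    refine le_trans (le_of_eq ?_) hb
    have := (hm0 m).ne'
    push_cast
    field_simp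
  have hlimN : Tendsto (fun m : ℕ => (m : ℝ) + 1) atTop atTop :=
    tendsto_atTop_add_const_right _ _ tendsto_natCast_atTop_atTop
  have hJlim : Tendsto (fun m => C.fisherReal (g m)) atTop (𝓝 0) := by
    refine squeeze_zero hg0 hJ' (tendsto_const_nhds.div_atTop ?_)
    exact tendsto_atTop_add_const_left _ _ (hlimN.const_mul_atTop (by positivity))
  have hElim := tendsto_entropy_zero hM hc hg hg1 hJlim
  have hDlim : Tendsto (fun m : ℕ => D / ((m : ℝ) + 1)) atTop (𝓝 0) :=
    tendsto_const_nhds.div_atTop hlimN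
  have hlim : Tendsto (fun m : ℕ => ∑' x, C.π x * (g m x * Real.log (g m x)) +
      extendZero (powerGrowth κ δ n) (C.fisherReal f) + D / ((m : ℝ) + 1)) atTop
      (𝓝 (extendZero (powerGrowth κ δ n) (C.fisherReal f))) := by
    simpa using (hElim.add_const (extendZero (powerGrowth κ δ n) (C.fisherReal f))).add hDlim
  refine ge_of_tendsto' hlim fun m => ?_
  have hΦ : 0 ≤ extendZero (powerGrowth κ δ n) (C.fisherReal (g m)) := by
    rw [← extendZero_powerGrowth_zero hκ hδ hn]
    exact monotoneOn_extendZero_powerGrowth hκ hδ hn self_mem_Ici (hg0 m) (hg0 m)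
  have h1 := hE m
  have h2 : (((m + 1) ^ 3 : ℕ) : ℝ) * (1 / ((m : ℝ) + 1) ^ 2) ^ 2 * D = D / ((m : ℝ) + 1) := by
    have := (hm0 m).ne'
    push_cast
    field_simp
  rw [h2] at h1
  linarith

/-! ### From bounded to general densities. -/

theorem fisherInfo_eq (C : ReversibleGenerator X) (f : X → ℝ) :
    fisherInfo C.k C.π f = (1 / 2) * ∑' p : X × X, ENNReal.ofReal (C.edge p *
      ((f p.2 - f p.1) * (Real.log (f p.2) - Real.log (f p.1)))) := by
  rw [fisherInfo, ENNReal.tsum_prod']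
  congr 1
  refine tsum_congr fun x => tsum_congr fun y => ?_
  congr 1
  have h := offRate_mul (k := C.k) (x := x) (y := y)
    (a := (f y - f x) * (Real.log (f y) - Real.log (f x))) fun h => by rw [h, sub_self, zero_mul]
  simp only [edge]
  rw [mul_assoc (C.π x), h]
  ring

theorem ofReal_fisherReal (hM : Summable fun x => M₁ C.k x ^ 2 * C.π x) (hc : 0 < c)
    (hf : ∀ x, f x ∈ Icc c B) :
    fisherInfo C.k C.π f = ENNReal.ofReal (C.fisherReal f) := by
  rw [fisherInfo_eq, fisherReal, ENNReal.ofReal_mul (by norm_num),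
    ENNReal.ofReal_tsum_of_nonneg (fun p => mul_nonneg (C.edge_nonneg p)
      (sub_mul_log_sub_log_nonneg (hc.trans_le (hf _).1) (hc.trans_le (hf _).1)))
      (summable_fisherReal hM hc hf), ENNReal.ofReal_div_of_pos two_pos]
  simp

/-- Truncation and normalisation do not increase the Fisher information, up to the factor of the
normalisation. -/
theorem fisherReal_clamp_le (hM : Summable fun x => M₁ C.k x ^ 2 * C.π x) {ε M z : ℝ}
    (hε : 0 < ε) (hεM : ε ≤ M) (hz : 0 < z) (hf : ∀ x, 0 < f x)
    (hI : fisherInfo C.k C.π f < ∞) :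
    C.fisherReal (fun x => clamp ε M (f x) / z) ≤ (fisherInfo C.k C.π f).toReal / z := by
  have hmem : ∀ x, clamp ε M (f x) / z ∈ Icc (ε / z) (M / z) := fun x =>
    ⟨div_le_div_of_nonneg_right (clamp_mem_Icc hεM _).1 hz.le,
      div_le_div_of_nonneg_right (clamp_mem_Icc hεM _).2 hz.le⟩
  have hle : fisherInfo C.k C.π (fun x => clamp ε M (f x) / z) ≤
      ENNReal.ofReal z⁻¹ * fisherInfo C.k C.π f := by
    rw [fisherInfo_eq, fisherInfo_eq, mul_left_comm,
      ← ENNReal.tsum_mul_left (a := ENNReal.ofReal z⁻¹)]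
    refine mul_le_mul_right (ENNReal.tsum_le_tsum fun p => ?_) _
    rw [← ENNReal.ofReal_mul (by positivity)]
    refine ENNReal.ofReal_le_ofReal ?_
    have hp := fun x => hε.trans_le (clamp_mem_Icc hεM (f x)).1
    -- The normalising constant cancels in the difference of logarithms, so it enters only once, as
    -- `z⁻¹`.
    rw [Real.log_div (hp _).ne' hz.ne', Real.log_div (hp _).ne' hz.ne']
    have h := mul_le_mul_of_nonneg_left (mul_le_mul_of_nonneg_left
      (clamp_mul_log_le hε (hε.trans_le hεM) (hf p.2) (hf p.1)) (C.edge_nonneg p))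
      (inv_nonneg.2 hz.le)
    refine le_trans (le_of_eq ?_) h
    field_simp
    ring
  rw [ofReal_fisherReal hM (div_pos hε hz) hmem] at hle
  have h2 := ENNReal.toReal_mono (ENNReal.mul_ne_top ENNReal.ofReal_ne_top hI.ne) hle
  rw [ENNReal.toReal_mul, ENNReal.toReal_ofReal (inv_nonneg.2 hz.le), ENNReal.toReal_ofReal
    (fisherReal_nonneg fun x => (div_pos hε hz).trans_le (hmem x).1)] at h2
  rw [div_eq_inv_mul]
  exact h2

/-- The density is truncated to `[1/(m+1), m+1]` and divided by its mass `z m`, which tends to `1`.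
The entropies converge by dominated convergence; on the right, only the upper bound `I(f) / z m` and
the monotonicity and continuity of `Φ` are needed. -/
theorem entropy_le (hM : Summable fun x => M₁ C.k x ^ 2 * C.π x) {κ δ n : ℝ}
    (hκ : 0 < κ) (hδ : 1 ≤ δ) (hn : 0 < n) (hCD : CDUpsilon C.k κ (powerCD δ n))
    (hf : ∀ x, 0 < f x) (hf1 : HasSum (fun x => f x * C.π x) 1)
    (hfe : FiniteEntropy C.π f) (hI : fisherInfo C.k C.π f < ∞) :
    entropy C.π f ≤ extendZero (powerGrowth κ δ n) (fisherInfo C.k C.π f).toReal := by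
  set ε : ℕ → ℝ := fun m => 1 / ((m : ℝ) + 1) with hεdef
  set M : ℕ → ℝ := fun m => (m : ℝ) + 1 with hMdef
  have hlimM : Tendsto M atTop atTop :=
    tendsto_atTop_add_const_right _ _ tendsto_natCast_atTop_atTop
  have hlimε : Tendsto ε atTop (𝓝 0) := tendsto_const_nhds.div_atTop hlimM
  have hM1 : ∀ m, 1 ≤ M m := fun m => by simp [hMdef]
  have hε0 : ∀ m, 0 < ε m := fun m => by simp only [hεdef]; positivity
  have hε1 : ∀ m, ε m ≤ 1 := fun m => (div_le_one (zero_lt_one.trans_le (hM1 m))).2 (hM1 m)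
  have hεM : ∀ m, ε m ≤ M m := fun m => (hε1 m).trans (hM1 m)
  have hcl := fun m x => clamp_mem_Icc (hεM m) (f x)
  have hcl0 : ∀ m x, 0 < clamp (ε m) (M m) (f x) := fun m x => (hε0 m).trans_le (hcl m x).1
  have hev : ∀ x, ∀ᶠ m in atTop, clamp (ε m) (M m) (f x) = f x := by
    intro x
    filter_upwards [hlimε.eventually_lt_const (hf x), hlimM.eventually_ge_atTop (f x)]
      with m h1 h2 using clamp_of_mem ⟨h1.le, h2⟩
  set z : ℕ → ℝ := fun m => ∑' x, clamp (ε m) (M m) (f x) * C.π x with hzdef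
  set S : ℕ → ℝ := fun m =>
    ∑' x, clamp (ε m) (M m) (f x) * Real.log (clamp (ε m) (M m) (f x)) * C.π x with hSdef
  have hclle : ∀ m x, clamp (ε m) (M m) (f x) ≤ f x + 1 := fun m x =>
    (min_le_left _ _).trans (max_le (by linarith) (by linarith [hε1 m, hf x]))
  have hdom1 : Summable fun x => (f x + 1) * C.π x :=
    (hf1.summable.add C.π_sum.summable).congr fun x => by ring
  have hdom2 : Summable fun x => (|f x * Real.log (f x)| + 1) * C.π x := by
    refine ((show Summable _ from hfe).norm.add C.π_sum.summable).congr fun x => ?_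
    rw [norm_mul, Real.norm_eq_abs, Real.norm_of_nonneg (C.π_pos x).le]
    ring
  have hzb : ∀ m x, ‖clamp (ε m) (M m) (f x) * C.π x‖ ≤ (f x + 1) * C.π x := fun m x => by
    rw [Real.norm_of_nonneg (mul_nonneg (hcl0 m x).le (C.π_pos x).le)]
    exact mul_le_mul_of_nonneg_right (hclle m x) (C.π_pos x).le
  have hSb : ∀ m x, ‖clamp (ε m) (M m) (f x) * Real.log (clamp (ε m) (M m) (f x)) * C.π x‖ ≤
      (|f x * Real.log (f x)| + 1) * C.π x := fun m x => by
    rw [norm_mul, Real.norm_of_nonneg (C.π_pos x).le]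
    exact mul_le_mul_of_nonneg_right (abs_clamp_mul_log_le (hε0 m) (hε1 m) (hεM m))
      (C.π_pos x).le
  have hzlim : Tendsto z atTop (𝓝 1) := by
    rw [← hf1.tsum_eq]
    refine tendsto_tsum_of_dominated_convergence hdom1 (fun x => ?_)
      (Eventually.of_forall hzb)
    exact tendsto_const_nhds.congr' ((hev x).mono fun m hm => by simp only [hm])
  have hSlim : Tendsto S atTop (𝓝 (∑' x, f x * Real.log (f x) * C.π x)) := by
    refine tendsto_tsum_of_dominated_convergence hdom2 (fun x => ?_)
      (Eventually.of_forall hSb)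
    exact tendsto_const_nhds.congr' ((hev x).mono fun m hm => by simp only [hm])
  have hzsum : ∀ m, HasSum (fun x => clamp (ε m) (M m) (f x) * C.π x) (z m) := fun m =>
    (Summable.of_norm_bounded hdom1 (hzb m)).hasSum
  have hSsum : ∀ m, HasSum (fun x => clamp (ε m) (M m) (f x) *
      Real.log (clamp (ε m) (M m) (f x)) * C.π x) (S m) := fun m =>
    (Summable.of_norm_bounded hdom2 (hSb m)).hasSum
  have hz0 : ∀ m, 0 < z m := fun m => (hε0 m).trans_le <| by
    have := hasSum_le (fun x => mul_le_mul_of_nonneg_right (hcl m x).1 (C.π_pos x).le)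
      (C.π_sum.mul_left (ε m)) (hzsum m)
    rwa [mul_one] at this
  -- The left side is the entropy of the normalised truncation.
  have hbound : ∀ m, S m / z m - Real.log (z m) ≤
      extendZero (powerGrowth κ δ n) ((fisherInfo C.k C.π f).toReal / z m) := by
    intro m
    have hmem : ∀ x, clamp (ε m) (M m) (f x) / z m ∈ Icc (ε m / z m) (M m / z m) := fun x =>
      ⟨div_le_div_of_nonneg_right (hcl m x).1 (hz0 m).le,
        div_le_div_of_nonneg_right (hcl m x).2 (hz0 m).le⟩
    have h1 : HasSum (fun x => clamp (ε m) (M m) (f x) / z m * C.π x) 1 := by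
      have := (hzsum m).div_const (z m)
      rw [div_self (hz0 m).ne'] at this
      exact this.congr_fun fun x => by ring
    have h2 := entropy_le_of_bounded hM hκ hδ hn hCD (div_pos (hε0 m) (hz0 m)) hmem h1
    have h3 : HasSum (fun x => C.π x * (clamp (ε m) (M m) (f x) / z m *
        Real.log (clamp (ε m) (M m) (f x) / z m))) (S m / z m - Real.log (z m)) := by
      have := ((hSsum m).div_const (z m)).sub (h1.mul_left (Real.log (z m)))
      rw [mul_one] at this
      refine this.congr_fun fun x => ?_
      rw [Real.log_div (hcl0 m x).ne' (hz0 m).ne']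
      ring
    rw [h3.tsum_eq] at h2
    have h4 := fisherReal_clamp_le hM (hε0 m) (hεM m) (hz0 m) hf hI
    have h5 : 0 ≤ C.fisherReal fun x => clamp (ε m) (M m) (f x) / z m :=
      fisherReal_nonneg fun x => div_pos (hcl0 m x) (hz0 m)
    exact h2.trans (monotoneOn_extendZero_powerGrowth hκ hδ hn h5 (h5.trans h4) h4)
  have hleft : Tendsto (fun m => S m / z m - Real.log (z m)) atTop
      (𝓝 (∑' x, f x * Real.log (f x) * C.π x)) := by
    have := (hSlim.div hzlim one_ne_zero).sub
      ((Real.continuousAt_log one_ne_zero).tendsto.comp hzlim)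
    simpa using this
  have hright : Tendsto (fun m => extendZero (powerGrowth κ δ n)
      ((fisherInfo C.k C.π f).toReal / z m)) atTop
      (𝓝 (extendZero (powerGrowth κ δ n) (fisherInfo C.k C.π f).toReal)) := by
    -- Continuity is taken within `[0, ∞)`, which includes the case of vanishing Fisher information.
    have hc := continuousOn_extendZero_powerGrowth hκ hδ hn
      (fisherInfo C.k C.π f).toReal ENNReal.toReal_nonneg
    refine hc.tendsto.comp (tendsto_nhdsWithin_iff.2 ⟨?_, Eventually.of_forall fun m =>
      div_nonneg ENNReal.toReal_nonneg (hz0 m).le⟩)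
    have := (tendsto_const_nhds (x := (fisherInfo C.k C.π f).toReal)).div hzlim one_ne_zero
    rw [div_one] at this
    exact this
  have hent : entropy C.π f = ∑' x, f x * Real.log (f x) * C.π x := by
    rw [entropy, hf1.tsum_eq, Real.log_one, mul_zero, sub_zero]
  rw [hent]
  exact le_of_tendsto_of_tendsto' hleft hright hbound

end ReversibleGenerator

end MarkovEI

end

theorem mainTheorem3 {X : Type*} [Countable X] [MeasurableSpace X] [DiscreteMeasurableSpace X]
    (C : MarkovEI.ReversibleGenerator X)
    (hM₁ : Summable fun x => MarkovEI.M₁ C.k x ^ 2 * C.π x)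
    (hM₂ : Summable fun x => MarkovEI.M₂ C.k x * C.π x)
    (hrec : C.PositiveRecurrent)
    (κ δ n : ℝ) (hκ : 0 < κ) (hδ : 1 ≤ δ) (hn : 0 < n)
    (hCD : MarkovEI.CDUpsilon C.k κ (MarkovEI.powerCD δ n)) :
    MarkovEI.EI C.k C.π (MarkovEI.powerGrowth κ δ n) ∧
    (∀ r : ℝ, 0 < r → IntegrableOn (fun v : ℝ => v ^ (δ - 2) / (v ^ δ + 1))
      (Ioi ((κ * n) ^ (1 / δ) / r))) ∧
    ((∃ B : ℝ, ∀ r : ℝ, 0 < r → |MarkovEI.powerGrowth κ δ n r| ≤ B) ↔ 1 < δ) ∧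
    IntegrableOn (fun s : ℝ => MarkovEI.powerGrowth κ δ n (s ^ 2) / s ^ 2) (Ioi 0) := by
  exact ⟨⟨MarkovEI.isGrowthFunction_powerGrowth hκ hδ hn, fun f hf hf1 hfe hI =>
      MarkovEI.ReversibleGenerator.entropy_le hM₁ hκ hδ hn hCD hf hf1 hfe hI⟩,
    fun r hr => MarkovEI.integrableOn_growthKernel (by linarith) (by positivity),
    MarkovEI.bounded_powerGrowth_iff hκ hδ hn, MarkovEI.integrableOn_powerGrowth_sq hκ hδ hn⟩
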